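/- Let $d\in\mathbb N$ and let $\phi=(\phi_{s,t})_{0\le s\le t}$ be a translation invariant Brownian flow on $\mathbb R^d$ over a probability space $(\Omega,\mathcal F,\mathbf P)$. That is: each $\phi_{s,t}(x)$, $x\in\mathbb R^d$, is a random vector; for every $\omega\in\Omega$, each $\phi_{s,t}(\cdot,\omega)$ is a homeomorphism of $\mathbb R^d$, $\phi_{s,u}=\phi_{t,u}\circ\phi_{s,t}$ for all $0\le s\le t\le u$, and $(s,t,x)\mapsto\phi_{s,t}(x,\omega)$ is continuous; $\phi_{t_0,t_1},\dots,\phi_{t_{n-1},t_n}$ are independent whenever $0\le t_0\le\dots\le t_n$; the law of $\phi_{s,t}$ depends only on $t-s$; and for each $a\in\mathbb R^d$ the random fields $(s,t,x)\mapsto\phi_{s,t}(x+a)-a$ and $(s,t,x)\mapsto\phi_{s,t}(x)$ have the same law. Write $\phi_t:=\phi_{0,t}$. Assume that, for every $\omega$, each $\phi_t$ is differentiable and $(t,x)\mapsto D\phi_t(x)$ is continuous on $[0,\infty)\times\mathbb R^d$. Assume moreover that there are constants $\bar c\ge 1$, $\Lambda\ge 0$, $\sigma>0$ and a standard Brownian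 motion $W$ on the same probability space such that for each $T\ge 0$, almost surely, $$\|D\phi_T(0)\|\le \bar c\,\exp\Big\{\sup_{0\le s\le T}(\Lambda s+\sigma W_s)\Big\},$$ where $\|\cdot\|$ is the operator norm. Then for each $u>0$ and each $\xi\ge 0$, $$\limsup_{T\to\infty}\frac1T\log\mathbf P\Big\{\sup_{|x|\le e^{-(\Lambda+\xi)T}}\ \sup_{0\le t\le T}|\phi_t(x)-\phi_t(0)|\ge u\Big\}\le-\frac{\xi^2}{2\sigma^2},$$ with the convention $\log 0=-\infty$. -/

import Mathlib

open MeasureTheory ProbabilityTheory Filter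
open scoped NNReal ENNReal Topology

/-- A (forward) stochastic flow of homeomorphisms of `ℝ^d`: random maps `φ s t ω`, `0 ≤ s ≤ t`,
that are homeomorphisms, compose as a flow, and are jointly continuous in `(s, t, x)`, for every
`ω`. Values `φ s t ω` with `t < s` are irrelevant. -/
structure IsStochasticFlow {d : ℕ} {Ω : Type*} [MeasurableSpace Ω]
    (φ : ℝ≥0 → ℝ≥0 → Ω → EuclideanSpace ℝ (Fin d) → EuclideanSpace ℝ (Fin d)) : Prop where
  measurable : ∀ s t : ℝ≥0, s ≤ t → ∀ x, Measurable (fun ω => φ s t ω x)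
  isHomeomorph : ∀ s t : ℝ≥0, s ≤ t → ∀ ω, IsHomeomorph (φ s t ω)
  comp : ∀ s t u : ℝ≥0, s ≤ t → t ≤ u → ∀ ω, φ s u ω = φ t u ω ∘ φ s t ω
  continuousOn : ∀ ω, ContinuousOn
    (fun p : ℝ≥0 × ℝ≥0 × EuclideanSpace ℝ (Fin d) => φ p.1 p.2.1 ω p.2.2) {p | p.1 ≤ p.2.1}

/-- A translation invariant Brownian flow: a stochastic flow of homeomorphisms with independent
and stationary increments whose law is invariant under shifts of `ℝ^d`. Random maps are regarded
as random elements of the function space with the σ-algebra generated by the evaluations. -/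
structure IsTranslationInvariantBrownianFlow {d : ℕ} {Ω : Type*} [MeasurableSpace Ω]
    (φ : ℝ≥0 → ℝ≥0 → Ω → EuclideanSpace ℝ (Fin d) → EuclideanSpace ℝ (Fin d))
    (P : Measure Ω) : Prop extends IsStochasticFlow φ where
  /-- For `t₀ ≤ t₁ ≤ … ≤ tₙ` the maps `φ_{t₀,t₁}, …, φ_{tₙ₋₁,tₙ}` are independent. -/
  indep_increments : ∀ (n : ℕ) (t : Fin (n + 1) → ℝ≥0), Monotone t →
    iIndepFun (fun (i : Fin n) (ω : Ω) => φ (t i.castSucc) (t i.succ) ω) P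
  /-- The law of `φ_{s,t}` depends only on `t - s`. -/
  stationary_increments : ∀ s t h : ℝ≥0, s ≤ t →
    IdentDistrib (fun ω => φ (s + h) (t + h) ω) (fun ω => φ s t ω) P P
  /-- For every `a`, the random fields `(s, t, x) ↦ φ_{s,t}(x + a) - a` and
  `(s, t, x) ↦ φ_{s,t}(x)` (indexed by `s ≤ t` and `x`) have the same law. -/
  translation_invariant : ∀ a : EuclideanSpace ℝ (Fin d),
    IdentDistrib
      (fun ω (p : {p : ℝ≥0 × ℝ≥0 // p.1 ≤ p.2}) (x : EuclideanSpace ℝ (Fin d)) =>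
        φ p.1.1 p.1.2 ω (x + a) - a)
      (fun ω (p : {p : ℝ≥0 × ℝ≥0 // p.1 ≤ p.2}) (x : EuclideanSpace ℝ (Fin d)) =>
        φ p.1.1 p.1.2 ω x) P P

/-! The proof is a Chernoff bound with exponent `p = ξ / σ ^ 2`, which minimises `p² σ² / 2 - p ξ`;
the minimum is `-ξ² / (2 σ²)`. Domination of `Dφ` by the running maximum of a Brownian motion with
drift gives, for each `b > p σ`, a bound `K exp ((p Λ + b² / 2) h)` on the `p`-th moment of `D =
sup_{t ≤ h} ‖Dφ_t(0)‖`, with `K` independent of `h` (`lintegral_iSup_enorm_fderiv_rpow_le`).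

If small balls grew like the derivative at their centre, the Markov property would bound the `p`-th
moment of the size at time `n h` by `m ^ n r ^ p`, with `m = K' exp ((p Λ + b² / 2) h)`. For `r =
exp (-(Λ + ξ) T)` and `n ≈ T / h`, Chebyshev then gives the rate `log K' / h + b² / 2 - p ξ`; large
`h` and `b` close to `p σ` finish.

The passage from derivative to ball is `exists_lintegral_osc_le`. Morrey's inequality, with
translation invariance, controls the oscillation by the `q`-th moment of `D`, but it requires `q >
d`, and used alone it would yield the rate `p Λ + p q σ² / 2` instead of `p Λ + p² σ² / 2`. It is
therefore applied only where the oscillation from radius `ρ` exceeds `ρ (D + 1)`. This event has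
vanishing probability as `ρ → 0`, so by Hölder its contribution is negligible below some radius `ρ₀`
depending on `h`.

As the one-step bound holds only up to `ρ₀`, the iteration (`lintegral_osc_step_le`) truncates the
oscillation at `ρ₀`. Since `ρ₀ < u` does not depend on `T`, reaching `u` forces reaching `ρ₀`, and
the factor `ρ₀ ^ (-p)` does not affect the rate. -/

/-! ### Limits of events along refining time grids. -/

/-- If every `A n` has measure at most `C`, so has any set of points eventually in `A n`. -/
theorem measure_le_of_eventually_mem {α : Type*} [MeasurableSpace α] {μ : Measure α}
    {A : ℕ → Set α} {S : Set α} {C : ℝ≥0∞} (hA : ∀ᶠ n in atTop, μ (A n) ≤ C)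
    (hS : ∀ ω ∈ S, ∀ᶠ n in atTop, ω ∈ A n) : μ S ≤ C := by
  have hmono : Monotone (fun n => ⋂ m : ℕ, ⋂ _ : n ≤ m, A m) := by
    intro a b hab ω hω
    simp only [Set.mem_iInter] at hω ⊢
    exact fun m hm => hω m (hab.trans hm)
  have hsub : S ⊆ ⋃ n, ⋂ m : ℕ, ⋂ _ : n ≤ m, A m := by
    intro ω hω
    obtain ⟨n, hn⟩ := eventually_atTop.1 (hS ω hω)
    simp only [Set.mem_iUnion, Set.mem_iInter]
    exact ⟨n, hn⟩
  refine (measure_mono hsub).trans ?_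
  -- Continuity from below along a monotone sequence needs no measurability, so `S` may be an event
  -- over uncountably many times and points.
  rw [hmono.measure_iUnion]
  refine iSup_le fun n => ?_
  obtain ⟨m, hm⟩ := (hA.and (eventually_ge_atTop n)).exists
  exact (measure_mono (Set.iInter₂_subset m hm.2)).trans hm.1

/-- The largest point of the grid `(h / N) ℕ` not exceeding `t`, as an index. -/
noncomputable def gridIndex (h : ℝ≥0) (N : ℕ) (t : ℝ≥0) : ℕ := ⌊t * N / h⌋₊

theorem gridIndex_le {h : ℝ≥0} (hh : 0 < h) (N : ℕ) {t : ℝ≥0} {n : ℕ} (ht : t ≤ n * h) :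
    gridIndex h N t ≤ n * N := by
  refine Nat.floor_le_of_le ?_
  rw [div_le_iff₀ hh]
  push_cast
  calc t * N ≤ n * h * N := by gcongr
    _ = n * N * h := by ring

theorem tendsto_grid {h : ℝ≥0} (hh : 0 < h) (t : ℝ≥0) :
    Tendsto (fun N : ℕ => (gridIndex h N t : ℝ≥0) * (h / N)) atTop (𝓝 t) := by
  have h1 : Tendsto (fun N : ℕ => (h / N : ℝ≥0)) atTop (𝓝 0) :=
    tendsto_const_div_atTop_nhds_zero_nat h
  have h2 : Tendsto (fun N : ℕ => t - (h / N : ℝ≥0)) atTop (𝓝 t) := by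
    simpa using tendsto_const_nhds.sub h1
  refine tendsto_of_tendsto_of_tendsto_of_le_of_le' h2 tendsto_const_nhds ?_ ?_
  · filter_upwards [eventually_gt_atTop 0] with N hN
    have hN' : (0 : ℝ≥0) < N := by exact_mod_cast hN
    have : t * N / h ≤ (gridIndex h N t : ℝ≥0) + 1 := (Nat.lt_floor_add_one _).le
    rw [tsub_le_iff_right]
    calc t = t * N / h * (h / N) := by field_simp
      _ ≤ ((gridIndex h N t : ℝ≥0) + 1) * (h / N) := by gcongr
      _ = _ := by ring
  · filter_upwards [eventually_gt_atTop 0] with N hN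
    have hN' : (0 : ℝ≥0) < N := by exact_mod_cast hN
    calc (gridIndex h N t : ℝ≥0) * (h / N) ≤ t * N / h * (h / N) := by
          gcongr; exact Nat.floor_le zero_le
      _ = t := by field_simp

/-! ### Maximal inequality and exponential moments of the Brownian running maximum. -/

section Brownian

variable {Ω : Type*} [MeasurableSpace Ω] {P : Measure Ω} {B : ℝ≥0 → Ω → ℝ}

theorem lintegral_exp_preBrownian (hB : IsPreBrownianReal B P) (b : ℝ) (t : ℝ≥0) :
    ∫⁻ ω, ENNReal.ofReal (Real.exp (b * B t ω)) ∂P = ENNReal.ofReal (Real.exp (b ^ 2 * t / 2)) := by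
  rw [(hB.hasLaw_eval t).lintegral_comp (f := fun x => ENNReal.ofReal (Real.exp (b * x)))
    (by fun_prop), ← ofReal_integral_eq_lintegral_ofReal (integrable_exp_mul_gaussianReal b)
    (ae_of_all _ fun x => (Real.exp_pos _).le)]
  congr 1
  have := mgf_gaussianReal (p := gaussianReal 0 t) (μ := 0) (v := t) (X := id) (by simp) b
  simp only [mgf, id] at this
  rw [this]
  congr 1
  ring

theorem nullMeasurableSet_exists_grid_gt (hB : IsPreBrownianReal B P) (y : ℝ) (δ : ℝ≥0) (k : ℕ) :
    NullMeasurableSet {ω | ∃ j ≤ k, y < B (j * δ) ω} P := by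
  have : {ω | ∃ j ≤ k, y < B (j * δ) ω} = ⋃ j : ℕ, ⋃ _ : j ≤ k, {ω | y < B (j * δ) ω} := by
    ext ω; simp
  rw [this]
  exact NullMeasurableSet.iUnion fun j => NullMeasurableSet.iUnion fun _ =>
    nullMeasurableSet_lt aemeasurable_const (hB.aemeasurable _)

/-- Exponential submartingale property on a past event. -/
theorem lintegral_past_exp_preBrownian_le (hB : IsPreBrownianReal B P) (b y : ℝ) (δ : ℝ≥0) (k : ℕ) :
    ∫⁻ ω, {ω | ∃ j ≤ k, y < B (j * δ) ω}.indicator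
        (fun ω => ENNReal.ofReal (Real.exp (b * B (k * δ) ω))) ω ∂P ≤
    ∫⁻ ω, {ω | ∃ j ≤ k, y < B (j * δ) ω}.indicator
        (fun ω => ENNReal.ofReal (Real.exp (b * B ((k + 1 : ℕ) * δ) ω))) ω ∂P := by
  have hle : ∀ j : ℕ, j ≤ k → (j * δ : ℝ≥0) ≤ k * δ := fun j hj => by gcongr
  -- The past event becomes a cylinder set of the path up to time `k δ`, hence independent of the
  -- next increment.
  let S : Set (Set.Iic ((k : ℝ≥0) * δ) → ℝ) :=
    ⋃ j : ℕ, ⋃ hj : j ≤ k, {x | y < x ⟨j * δ, hle j hj⟩}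
  have hS : MeasurableSet S := MeasurableSet.iUnion fun j => MeasurableSet.iUnion fun hj =>
    measurableSet_lt measurable_const (measurable_pi_apply _)
  let g : (Set.Iic ((k : ℝ≥0) * δ) → ℝ) → ℝ≥0∞ :=
    S.indicator fun x => ENNReal.ofReal (Real.exp (b * x ⟨k * δ, hle k le_rfl⟩))
  have hg : Measurable g := by
    refine Measurable.indicator ?_ hS
    have := measurable_pi_apply (X := fun _ : Set.Iic ((k : ℝ≥0) * δ) => ℝ) ⟨k * δ, hle k le_rfl⟩
    fun_prop
  let f : (ℝ≥0 → ℝ) → ℝ≥0∞ := fun x => ENNReal.ofReal (Real.exp (b * x δ))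
  have hf : Measurable f := by
    have := measurable_pi_apply (X := fun _ : ℝ≥0 => ℝ) δ
    fun_prop
  have hind := (hB.indepFun_shift (k * δ)).comp hf hg
  have hm : ∀ t, AEMeasurable (B t) P := hB.aemeasurable
  have e1 : ∫⁻ ω, f (fun t => B (k * δ + t) ω - B (k * δ) ω) ∂P =
      ENNReal.ofReal (Real.exp (b ^ 2 * δ / 2)) :=
    lintegral_exp_preBrownian (hB.shift (k * δ)) b δ
  have e2 : ∀ ω, g (fun t => B t ω) = {ω | ∃ j ≤ k, y < B (j * δ) ω}.indicator
        (fun ω => ENNReal.ofReal (Real.exp (b * B (k * δ) ω))) ω := by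
    intro ω
    simp only [g, S, Set.indicator, Set.mem_iUnion, Set.mem_ofPred_eq, exists_prop]
  have e3 : ∀ ω, f (fun t => B (k * δ + t) ω - B (k * δ) ω) * g (fun t => B t ω) =
      {ω | ∃ j ≤ k, y < B (j * δ) ω}.indicator
        (fun ω => ENNReal.ofReal (Real.exp (b * B ((k + 1 : ℕ) * δ) ω))) ω := by
    intro ω
    rw [e2]
    by_cases h : ω ∈ {ω | ∃ j ≤ k, y < B (j * δ) ω}
    · rw [Set.indicator_of_mem h, Set.indicator_of_mem h]
      simp only [f]
      rw [← ENNReal.ofReal_mul (Real.exp_pos _).le, ← Real.exp_add]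
      congr 2
      have : ((k + 1 : ℕ) : ℝ≥0) * δ = k * δ + δ := by push_cast; ring
      rw [this]; ring
    · rw [Set.indicator_of_notMem h, Set.indicator_of_notMem h, mul_zero]
  have hfm : AEMeasurable (f ∘ fun ω t => B (k * δ + t) ω - B (k * δ) ω) P := by
    have h1 := hm (k * δ + δ)
    have h2 := hm (k * δ)
    change AEMeasurable (fun ω => ENNReal.ofReal (Real.exp (b * (B (k * δ + δ) ω - B (k * δ) ω)))) P
    fun_prop
  have hgm : AEMeasurable (g ∘ fun ω (t : Set.Iic ((k : ℝ≥0) * δ)) => B t ω) P := by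
    have : (g ∘ fun ω (t : Set.Iic ((k : ℝ≥0) * δ)) => B t ω) = _ := funext e2
    rw [this]
    refine AEMeasurable.indicator₀ ?_ (nullMeasurableSet_exists_grid_gt hB y δ k)
    have h2 := hm (k * δ)
    fun_prop
  have key := lintegral_mul_eq_lintegral_mul_lintegral_of_indepFun'' hfm hgm hind
  simp only [Function.comp_def] at key
  rw [lintegral_congr e3, lintegral_congr e2, e1] at key
  rw [key]
  -- The independent increment contributes the factor `exp (b² δ / 2) ≥ 1`.
  refine le_mul_of_one_le_left' ?_
  rw [ENNReal.one_le_ofReal]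
  exact Real.one_le_exp (by positivity)

/-- Doob's maximal inequality for the exponential of a Brownian motion on a grid. -/
theorem exp_mul_measure_grid_le (hB : IsPreBrownianReal B P) {b : ℝ} (hb : 0 ≤ b) (y : ℝ)
    (δ : ℝ≥0) (k : ℕ) :
    ENNReal.ofReal (Real.exp (b * y)) * P {ω | ∃ j ≤ k, y < B (j * δ) ω} ≤
    ∫⁻ ω, {ω | ∃ j ≤ k, y < B (j * δ) ω}.indicator
        (fun ω => ENNReal.ofReal (Real.exp (b * B (k * δ) ω))) ω ∂P := by
  have hm : ∀ t, AEMeasurable (B t) P := hB.aemeasurable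
  have hA := nullMeasurableSet_exists_grid_gt hB y δ
  have hlow : ∀ (k : ℕ) (S : Set Ω), NullMeasurableSet S P → (∀ ω ∈ S, y < B (k * δ) ω) →
      ENNReal.ofReal (Real.exp (b * y)) * P S ≤
        ∫⁻ ω, S.indicator (fun ω => ENNReal.ofReal (Real.exp (b * B (k * δ) ω))) ω ∂P := by
    intro k S hS hSy
    rw [← lintegral_indicator_const₀ hS]
    refine lintegral_mono fun ω => ?_
    by_cases h : ω ∈ S
    · rw [Set.indicator_of_mem h, Set.indicator_of_mem h]
      have := (hSy ω h).le
      gcongr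
    · rw [Set.indicator_of_notMem h, Set.indicator_of_notMem h]
  induction k with
  | zero =>
    refine hlow 0 _ (hA 0) ?_
    rintro ω ⟨j, hj, hy⟩
    obtain rfl : j = 0 := by omega
    exact hy
  | succ k ih =>
    -- First-passage decomposition: on `A' \ A` the level is exceeded at the last grid time, while
    -- on `A` the submartingale property carries the bound from `k` to `k + 1`.
    set A := {ω | ∃ j ≤ k, y < B (j * δ) ω} with hAdef
    set A' := {ω | ∃ j ≤ k + 1, y < B (j * δ) ω} with hA'def
    have hsub : A ⊆ A' := by
      rintro ω ⟨j, hj, h⟩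
      exact ⟨j, by omega, h⟩
    have hdiff : ∀ ω ∈ A' \ A, y < B ((k + 1 : ℕ) * δ) ω := by
      rintro ω ⟨⟨j, hj, h⟩, hn⟩
      rcases Nat.lt_or_ge k j with h' | h'
      · obtain rfl : j = k + 1 := by omega
        exact h
      · exact absurd ⟨j, h', h⟩ hn
    have h1 := hlow (k + 1) (A' \ A) ((hA (k + 1)).diff (hA k)) hdiff
    have h2 := ih.trans (lintegral_past_exp_preBrownian_le hB b y δ k)
    have h3 : P A' ≤ P A + P (A' \ A) := by
      refine (measure_mono ?_).trans (measure_union_le _ _)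
      intro ω hω
      by_cases h : ω ∈ A
      · exact Or.inl h
      · exact Or.inr ⟨hω, h⟩
    calc _ ≤ ENNReal.ofReal (Real.exp (b * y)) * (P A + P (A' \ A)) := by gcongr
      _ = _ := mul_add _ _ _
      _ ≤ _ := add_le_add h2 h1
      _ = _ := by
        rw [← lintegral_add_left']
        · refine lintegral_congr fun ω => ?_
          by_cases h : ω ∈ A
          · have h' : ω ∉ A' \ A := fun hh => hh.2 h
            rw [Set.indicator_of_mem h, Set.indicator_of_notMem h',
              Set.indicator_of_mem (hsub h), add_zero]
          · rw [Set.indicator_of_notMem h, zero_add]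
            by_cases h' : ω ∈ A'
            · rw [Set.indicator_of_mem h', Set.indicator_of_mem (show ω ∈ A' \ A from ⟨h', h⟩)]
            · rw [Set.indicator_of_notMem h', Set.indicator_of_notMem fun hh => h' hh.1]
        · refine AEMeasurable.indicator₀ ?_ (hA k)
          have := hm ((k + 1 : ℕ) * δ)
          fun_prop

/-- Doob's inequality on grids of mesh `h / N` passes to the limit: by path continuity, the strict
inequality at `s` persists at nearby grid times. -/
theorem measure_exists_brownian_gt_le (hB : IsBrownianReal B P) {b : ℝ} (hb : 0 ≤ b) (y : ℝ)
    {h : ℝ≥0} (hh : 0 < h) :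
    P {ω | ∃ s ≤ h, y < B s ω} ≤ ENNReal.ofReal (Real.exp (b ^ 2 * h / 2 - b * y)) := by
  have hcont := hB.cont
  have hnull : P {ω | ¬ Continuous fun t => B t ω} = 0 := ae_iff.1 hcont
  have hsub : P {ω | ∃ s ≤ h, y < B s ω} ≤
      P ({ω | ∃ s ≤ h, y < B s ω} ∩ {ω | Continuous fun t => B t ω}) := by
    refine (measure_mono (t := ({ω | ∃ s ≤ h, y < B s ω} ∩ {ω | Continuous fun t => B t ω}) ∪
      {ω | ¬ Continuous fun t => B t ω}) ?_).trans ((measure_union_le _ _).trans ?_)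
    · intro ω hω
      by_cases hc : Continuous fun t => B t ω
      · exact Or.inl ⟨hω, hc⟩
      · exact Or.inr hc
    · rw [hnull, add_zero]
  refine hsub.trans ?_
  refine measure_le_of_eventually_mem (A := fun N => {ω | ∃ j ≤ N, y < B (j * (h / N)) ω}) ?_ ?_
  · filter_upwards [eventually_gt_atTop 0] with N hN
    have hN' : (0 : ℝ≥0) < N := by exact_mod_cast hN
    have h1 := exp_mul_measure_grid_le hB.toIsPreBrownianReal hb y (h / N) N
    have h2 : ∫⁻ ω, {ω | ∃ j ≤ N, y < B (j * (h / N)) ω}.indicator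
        (fun ω => ENNReal.ofReal (Real.exp (b * B (N * (h / N)) ω))) ω ∂P ≤
        ENNReal.ofReal (Real.exp (b ^ 2 * h / 2)) := by
      rw [← lintegral_exp_preBrownian hB.toIsPreBrownianReal b h]
      refine lintegral_mono fun ω => (Set.indicator_le_self _ _ ω).trans ?_
      rw [mul_div_cancel₀ _ hN'.ne']
    have h3 := h1.trans h2
    rw [Real.exp_sub, ENNReal.ofReal_div_of_pos (Real.exp_pos _),
      ENNReal.le_div_iff_mul_le (Or.inl (by simp [Real.exp_pos]))
        (Or.inl ENNReal.ofReal_ne_top), mul_comm]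
    exact h3
  · rintro ω ⟨⟨s, hs, hy⟩, hc⟩
    have ht := (hc.tendsto s).comp (tendsto_grid hh s)
    filter_upwards [ht.eventually (lt_mem_nhds hy)] with N hN
    exact ⟨gridIndex h N s, by simpa using gridIndex_le hh N (n := 1) (by simpa using hs), hN⟩

/-- Exponential moments of the running maximum of a Brownian motion. -/
theorem exists_exp_brownian_le (hB : IsBrownianReal B P) {a b : ℝ} (ha : 0 ≤ a) (hab : a < b)
    {h : ℝ≥0} (hh : 0 < h) :
    ∃ Z : Ω → ℝ≥0∞, Measurable Z ∧ (∀ ω, ∀ s ≤ h, ENNReal.ofReal (Real.exp (a * B s ω)) ≤ Z ω) ∧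
      ∫⁻ ω, Z ω ∂P ≤ ENNReal.ofReal ((1 + Real.exp a / (1 - Real.exp (a - b))) *
        Real.exp (b ^ 2 * h / 2)) := by
  have hb : 0 ≤ b := ha.trans hab.le
  have hP : IsProbabilityMeasure P := hB.toIsPreBrownianReal.isGaussianProcess.isProbabilityMeasure
  -- Measurable hulls leave the measures of these events unchanged and make `Z` measurable.
  let A : ℕ → Set Ω := fun i => toMeasurable P {ω | ∃ s ≤ h, (i : ℝ) < B s ω}
  have hA : ∀ i, MeasurableSet (A i) := fun i => measurableSet_toMeasurable _ _
  refine ⟨fun ω => 1 + ∑' i : ℕ, (A i).indicator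
    (fun _ => ENNReal.ofReal (Real.exp (a * (i + 1)))) ω, ?_, ?_, ?_⟩
  · have hm : ∀ i, Measurable ((A i).indicator
        (fun _ => ENNReal.ofReal (Real.exp (a * (i + 1))))) :=
      fun i => measurable_const.indicator (hA i)
    fun_prop
  · intro ω s hs
    rcases le_or_gt (B s ω) 0 with h0 | h0
    · refine le_add_right ?_
      rw [ENNReal.ofReal_le_one]
      exact Real.exp_le_one_iff.2 (mul_nonpos_of_nonneg_of_nonpos ha h0)
    · have hpos : 0 < ⌈B s ω⌉₊ := Nat.ceil_pos.2 h0
      obtain ⟨i, hi⟩ : ∃ i, ⌈B s ω⌉₊ = i + 1 := ⟨_, (Nat.succ_pred_eq_of_pos hpos).symm⟩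
      have hi1 : B s ω ≤ i + 1 := by
        have := Nat.le_ceil (B s ω)
        rw [hi] at this
        exact_mod_cast this
      have hi2 : (i : ℝ) < B s ω := Nat.lt_ceil.1 (by omega)
      have hmem : ω ∈ A i := subset_toMeasurable _ _ ⟨s, hs, hi2⟩
      refine le_add_left (le_trans ?_ (ENNReal.le_tsum i))
      rw [Set.indicator_of_mem hmem]
      gcongr
  · rw [lintegral_add_left measurable_const, lintegral_tsum fun i =>
      (measurable_const.indicator (hA i)).aemeasurable]
    have hr : Real.exp (a - b) < 1 := by
      rw [← Real.exp_zero]; exact Real.exp_lt_exp.2 (by linarith)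
    -- The weight `exp (a (i + 1))` against the tail `exp (-b i)` decays geometrically because `a <
    -- b`.
    have hterm : ∀ i : ℕ, ∫⁻ ω, (A i).indicator
        (fun _ => ENNReal.ofReal (Real.exp (a * (i + 1)))) ω ∂P ≤
        ENNReal.ofReal (Real.exp a * Real.exp (b ^ 2 * h / 2) * Real.exp (a - b) ^ i) := by
      intro i
      rw [lintegral_indicator_const (hA i), measure_toMeasurable]
      calc _ ≤ ENNReal.ofReal (Real.exp (a * (i + 1))) *
            ENNReal.ofReal (Real.exp (b ^ 2 * h / 2 - b * i)) := by
            gcongr; exact measure_exists_brownian_gt_le hB hb _ hh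
        _ = _ := by
            rw [← ENNReal.ofReal_mul (Real.exp_pos _).le, ← Real.exp_nat_mul, ← Real.exp_add,
              ← Real.exp_add, ← Real.exp_add]
            congr 2; ring
    have hsum : HasSum (fun i : ℕ => Real.exp a * Real.exp (b ^ 2 * h / 2) * Real.exp (a - b) ^ i)
        (Real.exp a * Real.exp (b ^ 2 * h / 2) * (1 - Real.exp (a - b))⁻¹) :=
      (hasSum_geometric_of_lt_one (Real.exp_pos _).le hr).mul_left _
    have hone : (1 : ℝ) ≤ Real.exp (b ^ 2 * h / 2) := Real.one_le_exp (by positivity)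
    have hpos : 0 < 1 - Real.exp (a - b) := by linarith
    calc _ ≤ ENNReal.ofReal (Real.exp (b ^ 2 * h / 2)) + ∑' i : ℕ, ENNReal.ofReal
          (Real.exp a * Real.exp (b ^ 2 * h / 2) * Real.exp (a - b) ^ i) := by
          gcongr with i
          · simpa using hone
          · exact hterm i
      _ = _ := by
          rw [← ENNReal.ofReal_tsum_of_nonneg (fun i => by positivity) hsum.summable, hsum.tsum_eq,
            ← ENNReal.ofReal_add (by positivity) (by positivity)]
          congr 1
          ring

end Brownian

/-! ### Oscillations of continuous maps and their measurability. -/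

section Oscillation

variable {E : Type*} [NormedAddCommGroup E] [NormedSpace ℝ E] [SecondCountableTopology E]

/-- A dense sequence in the closed unit ball. -/
noncomputable def unitSeq (E : Type*) [NormedAddCommGroup E] [SecondCountableTopology E]
    (n : ℕ) : E :=
  haveI : Nonempty (Metric.closedBall (0 : E) 1) := ⟨⟨0, by simp⟩⟩
  (TopologicalSpace.denseSeq (Metric.closedBall (0 : E) 1) n : E)

omit [NormedSpace ℝ E] in
theorem norm_unitSeq_le (n : ℕ) : ‖unitSeq E n‖ ≤ 1 := by
  have : Nonempty (Metric.closedBall (0 : E) 1) := ⟨⟨0, by simp⟩⟩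
  have := (TopologicalSpace.denseSeq (Metric.closedBall (0 : E) 1) n).2
  rwa [mem_closedBall_zero_iff] at this

omit [NormedSpace ℝ E] in
/-- A closed condition holds on the closed unit ball if it holds along `unitSeq`. -/
theorem unitSeq_induction {S : Set E} (hS : IsClosed S) (h : ∀ n, unitSeq E n ∈ S) {z : E}
    (hz : ‖z‖ ≤ 1) : z ∈ S := by
  have : Nonempty (Metric.closedBall (0 : E) 1) := ⟨⟨0, by simp⟩⟩
  have hd := TopologicalSpace.denseRange_denseSeq (Metric.closedBall (0 : E) 1)
  have hz' : z ∈ Metric.closedBall (0 : E) 1 := by simpa using hz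
  have := DenseRange.induction_on (p := fun w : Metric.closedBall (0 : E) 1 => (w : E) ∈ S) hd
    ⟨z, hz'⟩ (hS.preimage continuous_subtype_val) h
  exact this

/-- The oscillation `sup_{|z| ≤ ρ} |f (y + z) - f y|`, as a countable supremum. -/
noncomputable def osc (f : E → E) (y : E) (ρ : ℝ) : ℝ≥0∞ :=
  ⨆ n, edist (f (y + ρ • unitSeq E n)) (f y)

theorem edist_le_osc {f : E → E} (hf : Continuous f) (y : E) {ρ : ℝ} {z : E}
    (hz : ‖z‖ ≤ ρ) : edist (f (y + z)) (f y) ≤ osc f y ρ := by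
  have hρ : 0 ≤ ρ := (norm_nonneg z).trans hz
  have hz1 : ‖ρ⁻¹ • z‖ ≤ 1 := by
    rw [norm_smul, norm_inv, Real.norm_of_nonneg hρ]
    exact inv_mul_le_one_of_le₀ hz hρ
  have hzz : z = ρ • (ρ⁻¹ • z) := by
    rcases hρ.eq_or_lt with rfl | h
    · simpa using hz
    · rw [smul_smul, mul_inv_cancel₀ h.ne', one_smul]
  have hclosed : IsClosed {w : E | edist (f (y + ρ • w)) (f y) ≤ osc f y ρ} :=
    isClosed_le (by fun_prop) continuous_const
  have := unitSeq_induction hclosed (fun n => le_iSup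
    (fun n => edist (f (y + ρ • unitSeq E n)) (f y)) n) hz1
  rw [hzz]
  exact this

theorem osc_le {f : E → E} {y : E} {ρ : ℝ} (hρ : 0 ≤ ρ) {C : ℝ≥0∞}
    (h : ∀ z, ‖z‖ ≤ ρ → edist (f (y + z)) (f y) ≤ C) : osc f y ρ ≤ C := by
  refine iSup_le fun n => h _ ?_
  rw [norm_smul, Real.norm_of_nonneg hρ]
  exact mul_le_of_le_one_right hρ (norm_unitSeq_le n)

/-- The ball of radius `ρ` about `y` is sent by `f` into the ball about `f y` of radius `osc f y ρ`.
Finiteness matters because `toReal` sends `∞` to `0`. -/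
theorem osc_comp_le {f g : E → E} (hf : Continuous f) (hg : Continuous g) (y : E)
    {ρ : ℝ} (hρ : 0 ≤ ρ) (hfin : osc f y ρ ≠ ∞) :
    osc (g ∘ f) y ρ ≤ osc g (f y) (osc f y ρ).toReal := by
  refine osc_le hρ fun z hz => ?_
  have h1 := edist_le_osc hf y hz
  have h2 : ‖f (y + z) - f y‖ ≤ (osc f y ρ).toReal := by
    rw [← dist_eq_norm, dist_edist]
    exact ENNReal.toReal_mono hfin h1
  have := edist_le_osc hg (f y) h2
  simpa using this

variable [MeasurableSpace E] [BorelSpace E]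

/-- Continuous self-maps, with the σ-algebra generated by the evaluations. -/
abbrev ContSelfMap (E : Type*) [TopologicalSpace E] := {f : E → E // Continuous f}

-- Continuity of the maps makes evaluation jointly measurable; the Markov step needs this to
-- evaluate later increments at a random centre and radius.
omit [NormedSpace ℝ E] in
theorem measurable_eval : Measurable (fun p : ContSelfMap E × E => p.1.1 p.2) := by
  have h : Measurable (Function.uncurry fun (y : E) (f : ContSelfMap E) => f.1 y) :=
    measurable_uncurry_of_continuous_of_measurable (fun f => f.2)
      (fun y => (measurable_pi_apply y).comp measurable_subtype_coe)
  exact h.comp measurable_swap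

omit [NormedSpace ℝ E] in
theorem Measurable.eval_contSelfMap {α : Type*} [MeasurableSpace α] {f : α → ContSelfMap E}
    {y : α → E} (hf : Measurable f) (hy : Measurable y) : Measurable fun a => (f a).1 (y a) :=
  measurable_eval.comp (hf.prodMk hy)

theorem Measurable.osc {α : Type*} [MeasurableSpace α] {f : α → ContSelfMap E}
    {y : α → E} {ρ : α → ℝ} (hf : Measurable f) (hy : Measurable y) (hρ : Measurable ρ) :
    Measurable fun a => osc (f a).1 (y a) (ρ a) :=
  Measurable.iSup fun _ => (hf.eval_contSelfMap (hy.add (hρ.smul_const _))).edist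
    (hf.eval_contSelfMap hy)

/-- The partial compositions `f_{k-1} ∘ ⋯ ∘ f₀` of a finite sequence of maps. -/
def partialComp {N : ℕ} (f : Fin N → ContSelfMap E) : ℕ → ContSelfMap E
  | 0 => ⟨id, continuous_id⟩
  | k + 1 => if h : k < N then ⟨(f ⟨k, h⟩).1 ∘ (partialComp f k).1,
      (f ⟨k, h⟩).2.comp (partialComp f k).2⟩ else partialComp f k

omit [NormedSpace ℝ E] in
theorem measurable_partialComp {N : ℕ} (k : ℕ) :
    Measurable fun f : Fin N → ContSelfMap E => partialComp f k := by
  induction k with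
  | zero => exact measurable_const
  | succ k ih =>
    by_cases h : k < N
    · simp only [partialComp, h, dif_pos]
      refine Measurable.subtype_mk (measurable_pi_lambda _ fun x => ?_)
      exact (measurable_pi_apply _).eval_contSelfMap
        (ih.eval_contSelfMap measurable_const)
    · simpa only [partialComp, h, dif_neg, not_false_eq_true] using ih

end Oscillation

/-! ### Markov property of the flow on time grids. -/

section Flow

variable {d : ℕ} {Ω : Type*} [MeasurableSpace Ω]
  {φ : ℝ≥0 → ℝ≥0 → Ω → EuclideanSpace ℝ (Fin d) → EuclideanSpace ℝ (Fin d)}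
  {P : Measure Ω}

open Classical in
/-- The flow as a random element of the space of continuous maps. -/
noncomputable def IsStochasticFlow.toCont (hφ : IsStochasticFlow φ) (s t : ℝ≥0) (ω : Ω) :
    ContSelfMap (EuclideanSpace ℝ (Fin d)) :=
  if h : s ≤ t then ⟨φ s t ω, (hφ.isHomeomorph s t h ω).continuous⟩ else ⟨id, continuous_id⟩

theorem IsStochasticFlow.toCont_coe (hφ : IsStochasticFlow φ) {s t : ℝ≥0} (h : s ≤ t) (ω : Ω) :
    (hφ.toCont s t ω).1 = φ s t ω := by simp [IsStochasticFlow.toCont, h]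

theorem IsStochasticFlow.measurable_toCont (hφ : IsStochasticFlow φ) (s t : ℝ≥0) :
    Measurable (hφ.toCont s t) := by
  by_cases h : s ≤ t
  · have h' : hφ.toCont s t = fun ω => ⟨φ s t ω, (hφ.isHomeomorph s t h ω).continuous⟩ := by
      funext ω; simp [IsStochasticFlow.toCont, h]
    rw [h']
    exact Measurable.subtype_mk (measurable_pi_lambda _ fun x => hφ.measurable s t h x)
  · have h' : hφ.toCont s t = fun _ => ⟨id, continuous_id⟩ := by
      funext ω; simp [IsStochasticFlow.toCont, h]
    rw [h']
    exact measurable_const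

theorem IsStochasticFlow.self_apply (hφ : IsStochasticFlow φ) (s : ℝ≥0) (ω : Ω)
    (x : EuclideanSpace ℝ (Fin d)) : φ s s ω x = x := by
  have h := congrFun (hφ.comp s s s le_rfl le_rfl ω) x
  exact ((hφ.isHomeomorph s s le_rfl ω).injective h).symm

theorem IsTranslationInvariantBrownianFlow.iIndepFun_toCont
    (hφ : IsTranslationInvariantBrownianFlow φ P) (n : ℕ) (t : Fin (n + 1) → ℝ≥0)
    (ht : Monotone t) :
    iIndepFun (fun (i : Fin n) (ω : Ω) => hφ.toCont (t i.castSucc) (t i.succ) ω) P := by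
  have h := hφ.indep_increments n t ht
  rw [iIndepFun_iff_iIndep] at h ⊢
  convert h using 2 with i
  change MeasurableSpace.comap _ (MeasurableSpace.comap _ _) = _
  rw [MeasurableSpace.comap_comp]
  congr 1
  funext ω
  exact hφ.toCont_coe (ht (Fin.castSucc_lt_succ).le) ω

theorem IsTranslationInvariantBrownianFlow.map_toCont_eq
    (hφ : IsTranslationInvariantBrownianFlow φ P) {s t : ℝ≥0} (hst : s ≤ t) (h : ℝ≥0) :
    P.map (hφ.toCont (s + h) (t + h)) = P.map (hφ.toCont s t) := by
  have key := hφ.stationary_increments s t h hst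
  refine Measure.ext fun S hS => ?_
  obtain ⟨T, hT, rfl⟩ := hS
  rw [Measure.map_apply (hφ.measurable_toCont _ _) ⟨T, hT, rfl⟩,
    Measure.map_apply (hφ.measurable_toCont _ _) ⟨T, hT, rfl⟩]
  have hle : s + h ≤ t + h := by gcongr
  have := key.measure_mem_eq hT
  convert this using 2
  · ext ω; simp [hφ.toCont_coe hle]
  · ext ω; simp [hφ.toCont_coe hst]

/-- The increments of the flow along the grid `s, s + δ, …, s + N δ`. -/
noncomputable def IsStochasticFlow.gridIncr (hφ : IsStochasticFlow φ) (s δ : ℝ≥0) (N : ℕ) (ω : Ω)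
    (k : Fin N) : ContSelfMap (EuclideanSpace ℝ (Fin d)) :=
  hφ.toCont (s + (k : ℕ) * δ) (s + ((k : ℕ) + 1 : ℕ) * δ) ω

theorem IsStochasticFlow.measurable_gridIncr (hφ : IsStochasticFlow φ) (s δ : ℝ≥0) (N : ℕ) :
    Measurable (hφ.gridIncr s δ N) :=
  measurable_pi_lambda _ fun _ => hφ.measurable_toCont _ _

theorem IsStochasticFlow.partialComp_gridIncr (hφ : IsStochasticFlow φ) (s δ : ℝ≥0) (N : ℕ)
    (ω : Ω) {k : ℕ} (hk : k ≤ N) :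
    (partialComp (hφ.gridIncr s δ N ω) k).1 = φ s (s + k * δ) ω := by
  induction k with
  | zero =>
    funext x
    simp [partialComp, hφ.self_apply]
  | succ k ih =>
    have h : k < N := hk
    have hle : s + (k : ℝ≥0) * δ ≤ s + ((k + 1 : ℕ) : ℝ≥0) * δ := by gcongr; simp
    simp only [partialComp, h, dif_pos]
    rw [ih h.le, IsStochasticFlow.gridIncr, hφ.toCont_coe hle]
    exact (hφ.comp _ _ _ (by simp) hle ω).symm

theorem IsTranslationInvariantBrownianFlow.map_gridIncr_eq [IsProbabilityMeasure P]
    (hφ : IsTranslationInvariantBrownianFlow φ P) (s δ : ℝ≥0) (N : ℕ) :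
    P.map (hφ.gridIncr s δ N) = P.map (hφ.gridIncr 0 δ N) := by
  have key : ∀ s : ℝ≥0, P.map (hφ.gridIncr s δ N) =
      Measure.pi fun k : Fin N => P.map fun ω => hφ.gridIncr s δ N ω k := by
    intro s
    refine (iIndepFun_iff_map_fun_eq_pi_map
      (fun i => (hφ.measurable_toCont _ _).aemeasurable)).1 ?_
    exact hφ.iIndepFun_toCont N (fun k => s + (k : ℕ) * δ) (fun a b hab => by
      have : (a : ℕ) ≤ b := hab
      dsimp only
      gcongr)
  rw [key s, key 0]
  congr 1
  funext k
  have := hφ.map_toCont_eq (s := 0 + (k : ℕ) * δ) (t := 0 + ((k : ℕ) + 1 : ℕ) * δ)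
    (by gcongr; simp) s
  simp only [zero_add] at this
  simp only [IsStochasticFlow.gridIncr, zero_add]
  rw [← this]
  simp only [add_comm s]

theorem IsTranslationInvariantBrownianFlow.indepFun_gridIncr [IsProbabilityMeasure P]
    (hφ : IsTranslationInvariantBrownianFlow φ P) (s δ : ℝ≥0) (N : ℕ) :
    IndepFun (hφ.toCont 0 s) (hφ.gridIncr s δ N) P := by
  -- Prefixing the grid with time `0` makes `φ_{0,s}` the zeroth of `N + 1` independent increments.
  let tt : ℕ → ℝ≥0 := fun k => match k with
    | 0 => 0
    | k + 1 => s + k * δ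
  have htt : Monotone tt := by
    refine monotone_nat_of_le_succ fun k => ?_
    match k with
    | 0 => exact zero_le
    | k + 1 =>
      change s + (k : ℝ≥0) * δ ≤ s + ((k + 1 : ℕ) : ℝ≥0) * δ
      gcongr; simp
  have hI := hφ.iIndepFun_toCont (N + 1) (fun i => tt i) (fun a b hab => htt hab)
  have h2 := hI.indepFun_finset {0} (Finset.univ.erase 0) (by simp)
    (fun i => hφ.measurable_toCont _ _)
  let E := EuclideanSpace ℝ (Fin d)
  have m0 : Measurable fun x : ({0} : Finset (Fin (N + 1))) → ContSelfMap E =>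
    x ⟨0, by simp⟩ := measurable_pi_apply _
  have m1 : Measurable fun (x : (Finset.univ.erase 0 : Finset (Fin (N + 1))) → ContSelfMap E)
      (k : Fin N) => x ⟨k.succ, by simp⟩ := measurable_pi_lambda _ fun k => measurable_pi_apply _
  have h3 := h2.comp m0 m1
  convert h3 using 1
  · funext ω
    simp [tt]
  · rfl

/-- Given `φ_{0,s}`, the increments after time `s` can be replaced by those of an independent
copy of the flow started at time `0`. -/
theorem IsTranslationInvariantBrownianFlow.lintegral_toCont_gridIncr [IsProbabilityMeasure P]
    (hφ : IsTranslationInvariantBrownianFlow φ P) (s δ : ℝ≥0) (N : ℕ)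
    {F : ContSelfMap (EuclideanSpace ℝ (Fin d)) ×
      (Fin N → ContSelfMap (EuclideanSpace ℝ (Fin d))) → ℝ≥0∞} (hF : Measurable F) :
    ∫⁻ ω, F (hφ.toCont 0 s ω, hφ.gridIncr s δ N ω) ∂P =
      ∫⁻ ω, ∫⁻ ω', F (hφ.toCont 0 s ω, hφ.gridIncr 0 δ N ω') ∂P ∂P := by
  have h1 := hφ.measurable_toCont 0 s
  have h2 := hφ.measurable_gridIncr s δ N
  have h3 := hφ.measurable_gridIncr 0 δ N
  have : IsProbabilityMeasure (P.map (hφ.gridIncr 0 δ N)) :=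
    Measure.isProbabilityMeasure_map h3.aemeasurable
  have h := (indepFun_iff_map_prod_eq_prod_map_map h1.aemeasurable h2.aemeasurable).1
    (hφ.indepFun_gridIncr s δ N)
  rw [← lintegral_map (f := F) (g := fun ω => (hφ.toCont 0 s ω, hφ.gridIncr s δ N ω)) hF
    (h1.prodMk h2), h, hφ.map_gridIncr_eq, lintegral_prod _ hF.aemeasurable,
    lintegral_map hF.lintegral_prod_right' h1]
  refine lintegral_congr fun ω => ?_
  exact lintegral_map (hF.comp measurable_prodMk_left) h3

/-- The law of the oscillation on the time grid does not depend on the base point. -/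
theorem IsTranslationInvariantBrownianFlow.lintegral_osc_grid
    (hφ : IsTranslationInvariantBrownianFlow φ P) (δ : ℝ≥0) (N : ℕ) (p : ℝ)
    (y : EuclideanSpace ℝ (Fin d)) (ρ : ℝ) :
    ∫⁻ ω, (⨆ k : ℕ, ⨆ _ : k ≤ N, osc (φ 0 (k * δ) ω) y ρ) ^ p ∂P =
      ∫⁻ ω, (⨆ k : ℕ, ⨆ _ : k ≤ N, osc (φ 0 (k * δ) ω) 0 ρ) ^ p ∂P := by
  let E := EuclideanSpace ℝ (Fin d)
  let G : ({p : ℝ≥0 × ℝ≥0 // p.1 ≤ p.2} → E → E) → ℝ≥0∞ := fun f =>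
    (⨆ k : ℕ, ⨆ _ : k ≤ N, osc (f ⟨(0, k * δ), zero_le⟩) 0 ρ) ^ p
  have hG : Measurable G := by
    refine Measurable.pow_const ?_ p
    refine Measurable.iSup fun k => Measurable.iSup fun _ => Measurable.iSup fun n => ?_
    exact Measurable.edist ((measurable_pi_apply _).comp (measurable_pi_apply _))
      ((measurable_pi_apply _).comp (measurable_pi_apply _))
  have h := ((hφ.translation_invariant y).comp hG).lintegral_eq
  refine Eq.trans (lintegral_congr fun ω => ?_) h
  simp only [G, Function.comp, osc, zero_add, edist_sub_right, add_comm _ y, add_zero]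
  rfl

/-- Markov property: a bound for the oscillation over one time step of length `N δ`, from radii
up to `ρ₀`, iterates. -/
theorem IsTranslationInvariantBrownianFlow.lintegral_osc_step_le [IsProbabilityMeasure P]
    (hφ : IsTranslationInvariantBrownianFlow φ P) (s δ : ℝ≥0) (N : ℕ) {p : ℝ} (hp : 0 < p)
    {m : ℝ≥0∞} (hm : 1 ≤ m) {ρ₀ : ℝ≥0}
    (hstep : ∀ ρ : ℝ≥0, ρ ≤ ρ₀ →
      ∫⁻ ω, (⨆ k : ℕ, ⨆ _ : k ≤ N, osc (φ 0 (k * δ) ω) 0 ρ) ^ p ∂P ≤ m * (ρ : ℝ≥0∞) ^ p)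
    {r : ℝ} (hr : 0 ≤ r) :
    ∫⁻ ω, (min (⨆ k : ℕ, ⨆ _ : k ≤ N, osc (φ 0 (s + k * δ) ω) 0 r) ρ₀) ^ p ∂P ≤
      m * ∫⁻ ω, (min (osc (φ 0 s ω) 0 r) ρ₀) ^ p ∂P := by
  classical
  let E := EuclideanSpace ℝ (Fin d)
  -- `F` is the oscillation of the later increments at the centre and radius reached at time `s`.
  -- Beyond `ρ₀`, where `hstep` gives nothing, it takes the truncation value.
  let F : ContSelfMap E × (Fin N → ContSelfMap E) → ℝ≥0∞ := fun q =>
    if osc q.1.1 0 r ≤ ρ₀ then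
      (⨆ k : ℕ, ⨆ _ : k ≤ N, osc (partialComp q.2 k).1 (q.1.1 0) (osc q.1.1 0 r).toReal) ^ p
    else (ρ₀ : ℝ≥0∞) ^ p
  have hosc : Measurable fun q : ContSelfMap E × (Fin N → ContSelfMap E) => osc q.1.1 0 r :=
    measurable_fst.osc measurable_const measurable_const
  have hF : Measurable F := by
    refine Measurable.ite (measurableSet_le hosc measurable_const) ?_ measurable_const
    refine Measurable.pow_const (Measurable.iSup fun k => Measurable.iSup fun _ => ?_) p
    exact ((measurable_partialComp k).comp measurable_snd).osc
      (measurable_fst.eval_contSelfMap measurable_const) hosc.ennreal_toReal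
  have hcont : ∀ {s t : ℝ≥0}, s ≤ t → ∀ ω, Continuous (φ s t ω) :=
    fun h ω => (hφ.isHomeomorph _ _ h ω).continuous
  calc _ ≤ ∫⁻ ω, F (hφ.toCont 0 s ω, hφ.gridIncr s δ N ω) ∂P := by
        refine lintegral_mono fun ω => ?_
        simp only [F, hφ.toCont_coe (zero_le (a := s))]
        split_ifs with h
        · refine ENNReal.rpow_le_rpow ((min_le_left _ _).trans ?_) hp.le
          refine iSup₂_mono fun k hk => ?_
          rw [hφ.partialComp_gridIncr s δ N ω hk,
            hφ.comp 0 s (s + k * δ) zero_le (by simp) ω]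
          exact osc_comp_le (hcont zero_le ω) (hcont (by simp) ω) 0 hr
            (h.trans_lt ENNReal.coe_lt_top).ne
        · exact ENNReal.rpow_le_rpow (min_le_right _ _) hp.le
    _ = ∫⁻ ω, ∫⁻ ω', F (hφ.toCont 0 s ω, hφ.gridIncr 0 δ N ω') ∂P ∂P :=
        hφ.lintegral_toCont_gridIncr s δ N hF
    _ ≤ ∫⁻ ω, m * (min (osc (φ 0 s ω) 0 r) ρ₀) ^ p ∂P := by
        refine lintegral_mono fun ω => ?_
        simp only [F, hφ.toCont_coe (zero_le (a := s))]
        split_ifs with h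
        · rw [min_eq_left h]
          have hfin : osc (φ 0 s ω) 0 r ≠ ∞ := (h.trans_lt ENNReal.coe_lt_top).ne
          obtain ⟨ρ, hρ⟩ : ∃ ρ : ℝ≥0, (ρ : ℝ≥0∞) = osc (φ 0 s ω) 0 r :=
            ⟨_, ENNReal.coe_toNNReal hfin⟩
          rw [← hρ] at h ⊢
          refine le_trans (le_of_eq ?_) (hstep ρ (by exact_mod_cast h))
          -- The centre `φ 0 s ω 0` is frozen in the inner integral, so translation invariance moves
          -- it to the origin.
          rw [← hφ.lintegral_osc_grid δ N p (φ 0 s ω 0) ρ]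
          refine lintegral_congr fun ω' => ?_
          congr 1
          refine iSup_congr fun k => iSup_congr fun hk => ?_
          rw [hφ.partialComp_gridIncr 0 δ N ω' hk]
          simp
        -- Once past `ρ₀` the truncated value cannot grow, and `1 ≤ m` suffices.
        · rw [min_eq_right (not_le.1 h).le]
          simp only [lintegral_const, measure_univ, mul_one]
          exact le_mul_of_one_le_left' hm
    _ = _ := by
        refine lintegral_const_mul _ ?_
        have : Measurable fun ω => osc (hφ.toCont 0 s ω).1 0 r :=
          (hφ.measurable_toCont 0 s).osc measurable_const measurable_const
        simp only [hφ.toCont_coe (zero_le (a := s))] at this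
        exact (this.min measurable_const).pow_const p

end Flow

/-! ### Morrey's inequality. -/

section Morrey

variable {E : Type*} [NormedAddCommGroup E] [NormedSpace ℝ E] [MeasurableSpace E] [BorelSpace E]
  [FiniteDimensional ℝ E]

theorem lintegral_comp_add_smul_sub (μ : Measure E) [μ.IsAddHaarMeasure] {G : E → ℝ≥0∞}
    (hG : Measurable G) (x : E) {s : ℝ} (hs : 0 < s) :
    ∫⁻ y, G (x + s • (y - x)) ∂μ =
      ENNReal.ofReal (s ^ Module.finrank ℝ E)⁻¹ * ∫⁻ y, G y ∂μ := by
  have h1 : ∀ y, x + s • (y - x) = (x - s • x) + s • y := fun y => by rw [smul_sub]; abel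
  simp_rw [h1]
  have hm : Measurable fun y : E => G ((x - s • x) + y) := by fun_prop
  rw [← lintegral_map (f := fun z => G ((x - s • x) + z)) (g := fun y => s • y) hm (by fun_prop),
    Measure.map_addHaar_smul μ hs.ne', lintegral_smul_measure, lintegral_add_left_eq_self,
    abs_of_pos (by positivity), smul_eq_mul]

/-- The constant `∫₀¹ s^{-n/q} ds` in Morrey's inequality. -/
noncomputable def morreyConst (n : ℕ) (q : ℝ) : ℝ≥0∞ :=
  ∫⁻ s in Set.Ioc (0 : ℝ) 1, ENNReal.ofReal (s ^ n)⁻¹ ^ (1 / q)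

/-- The singularity `s ^ (-n / q)` is integrable at `0` because `n < q`; this is the source of the
requirement `q > d`. -/
theorem morreyConst_ne_top {n : ℕ} {q : ℝ} (hq : 0 < q) (hn : n < q) : morreyConst n q ≠ ∞ := by
  have hlt : (-1 : ℝ) < -(n / q) := by
    rw [neg_lt_neg_iff, div_lt_one hq]; exact hn
  have h := (intervalIntegral.intervalIntegrable_rpow' (a := 0) (b := 1) hlt).1.lintegral_lt_top
  refine ne_of_eq_of_ne (setLIntegral_congr_fun measurableSet_Ioc fun s hs => ?_) h.ne
  have hs0 : 0 < s := hs.1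
  rw [ENNReal.ofReal_rpow_of_pos (by positivity)]
  congr 1
  rw [← Real.rpow_natCast, ← Real.rpow_neg hs0.le, ← Real.rpow_mul hs0.le]
  congr 1
  ring

/-- The averaged form of Morrey's inequality. -/
theorem setLIntegral_edist_le (μ : Measure E) [μ.IsAddHaarMeasure] {f : E → E} {M : E → ℝ≥0∞}
    (hM : Measurable M)
    (hf : ∀ x y, edist (f x) (f y) ≤ edist x y * ∫⁻ s in Set.Ioc (0 : ℝ) 1, M (x + s • (y - x)))
    {q : ℝ} (hq : 1 < q) {ρ : ℝ} {x : E} (hx : x ∈ Metric.closedBall (0 : E) ρ) :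
    ∫⁻ y in Metric.closedBall 0 ρ, edist (f x) (f y) ∂μ ≤
      ENNReal.ofReal (2 * ρ) * (morreyConst (Module.finrank ℝ E) q *
        ((∫⁻ y in Metric.closedBall 0 ρ, M y ^ q ∂μ) ^ (1 / q) *
          μ (Metric.closedBall 0 ρ) ^ (1 - 1 / q))) := by
  set S := Metric.closedBall (0 : E) ρ with hS
  have hSm : MeasurableSet S := Metric.isClosed_closedBall.measurableSet
  have hq0 : 0 < q := by linarith
  have hinner : ∀ s ∈ Set.Ioc (0 : ℝ) 1, ∫⁻ y in S, M (x + s • (y - x)) ∂μ ≤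
      ENNReal.ofReal (s ^ Module.finrank ℝ E)⁻¹ ^ (1 / q) *
        ((∫⁻ y in S, M y ^ q ∂μ) ^ (1 / q) * μ S ^ (1 - 1 / q)) := by
    intro s hs
    have hconj := Real.HolderConjugate.conjExponent hq
    have hmeas : Measurable fun y => M (x + s • (y - x)) := by fun_prop
    have h1 := ENNReal.lintegral_mul_le_Lp_mul_Lq (μ.restrict S) hconj
      (f := fun y => M (x + s • (y - x))) (g := fun _ => 1) hmeas.aemeasurable aemeasurable_const
    have hexp : 1 / q.conjExponent = 1 - 1 / q := by
      have := hconj.inv_add_inv_eq_one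
      rw [one_div, one_div]; linarith
    simp only [Pi.mul_apply, mul_one, ENNReal.one_rpow, lintegral_const,
      Measure.restrict_apply_univ, one_mul, hexp] at h1
    refine h1.trans ?_
    rw [← mul_assoc]
    gcongr
    rw [← ENNReal.mul_rpow_of_nonneg _ _ (by positivity)]
    gcongr
    -- The homothety of ratio `s` centred at `x` maps the ball into itself by convexity, at the cost
    -- of the Jacobian factor `s ^ (-n)`.
    rw [← lintegral_indicator hSm (fun y => M y ^ q),
      ← lintegral_comp_add_smul_sub μ ((hM.pow_const q).indicator hSm) x hs.1,
      ← lintegral_indicator hSm]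
    refine lintegral_mono fun y => ?_
    by_cases hy : y ∈ S
    · have hmem : x + s • (y - x) ∈ S :=
        (convex_closedBall (0 : E) ρ).add_smul_sub_mem hx hy ⟨hs.1.le, hs.2⟩
      rw [Set.indicator_of_mem hy, Set.indicator_of_mem hmem]
    · rw [Set.indicator_of_notMem hy]; exact zero_le
  calc _ ≤ ∫⁻ y in S, (ENNReal.ofReal (2 * ρ) *
        ∫⁻ s in Set.Ioc (0 : ℝ) 1, M (x + s • (y - x))) ∂μ := by
        refine setLIntegral_mono' hSm fun y hy => (hf x y).trans ?_
        gcongr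
        rw [edist_dist]
        gcongr
        have h1 : ‖x‖ ≤ ρ := by simpa [S] using hx
        have h2 : ‖y‖ ≤ ρ := by simpa [S] using hy
        rw [dist_eq_norm]
        linarith [norm_sub_le x y]
    _ = ENNReal.ofReal (2 * ρ) *
        ∫⁻ y in S, (∫⁻ s in Set.Ioc (0 : ℝ) 1, M (x + s • (y - x))) ∂μ :=
        lintegral_const_mul' _ _ ENNReal.ofReal_ne_top
    _ = ENNReal.ofReal (2 * ρ) *
        ∫⁻ s in Set.Ioc (0 : ℝ) 1, (∫⁻ y in S, M (x + s • (y - x)) ∂μ) := by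
        rw [lintegral_lintegral_swap]
        refine Measurable.aemeasurable ?_
        simp only [Function.uncurry_def]
        fun_prop
    _ ≤ ENNReal.ofReal (2 * ρ) * ∫⁻ s in Set.Ioc (0 : ℝ) 1,
        ENNReal.ofReal (s ^ Module.finrank ℝ E)⁻¹ ^ (1 / q) *
        ((∫⁻ y in S, M y ^ q ∂μ) ^ (1 / q) * μ S ^ (1 - 1 / q)) := by
        gcongr 1
        exact setLIntegral_mono' measurableSet_Ioc hinner
    _ = _ := by
        rw [lintegral_mul_const _ (by fun_prop)]
        rfl

/-- Morrey's inequality on a ball. -/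
theorem edist_zero_rpow_le (μ : Measure E) [μ.IsAddHaarMeasure] {f : E → E} {M : E → ℝ≥0∞}
    (hM : Measurable M) (hfm : Continuous f)
    (hf : ∀ x y, edist (f x) (f y) ≤ edist x y * ∫⁻ s in Set.Ioc (0 : ℝ) 1, M (x + s • (y - x)))
    {q : ℝ} (hq : 1 < q) {ρ : ℝ} (hρ : 0 < ρ) {x : E} (hx : x ∈ Metric.closedBall (0 : E) ρ) :
    edist (f x) (f 0) ^ q ≤ (ENNReal.ofReal (4 * ρ) * morreyConst (Module.finrank ℝ E) q) ^ q *
      ((μ (Metric.closedBall 0 ρ))⁻¹ * ∫⁻ y in Metric.closedBall 0 ρ, M y ^ q ∂μ) := by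
  set S := Metric.closedBall (0 : E) ρ with hS
  have hSm : MeasurableSet S := Metric.isClosed_closedBall.measurableSet
  have hq0 : 0 < q := by linarith
  have hS0 : μ S ≠ 0 := (Metric.measure_closedBall_pos μ 0 hρ).ne'
  have hSt : μ S ≠ ∞ := measure_closedBall_lt_top.ne
  set I := ∫⁻ y in S, M y ^ q ∂μ with hI
  set K := morreyConst (Module.finrank ℝ E) q with hK
  have h0 : (0 : E) ∈ S := by simp [S, hρ.le]
  have h1 := setLIntegral_edist_le μ hM hf hq hx
  have h2 := setLIntegral_edist_le μ hM hf hq h0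
  -- Both `f x` and `f 0` are compared with `f y`, and the triangle inequality is integrated over
  -- `y` in the ball.
  have hsum : μ S * edist (f x) (f 0) ≤
      ENNReal.ofReal (4 * ρ) * (K * (I ^ (1 / q) * μ S ^ (1 - 1 / q))) := by
    calc μ S * edist (f x) (f 0) = ∫⁻ _ in S, edist (f x) (f 0) ∂μ := by
          rw [lintegral_const, Measure.restrict_apply_univ, mul_comm]
      _ ≤ ∫⁻ y in S, (edist (f x) (f y) + edist (f 0) (f y)) ∂μ :=
          lintegral_mono fun y => by
            rw [edist_comm (f 0)]; exact edist_triangle _ _ _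
      _ = _ := lintegral_add_left (by fun_prop) _
      _ ≤ _ := add_le_add h1 h2
      _ = _ := by
          rw [← two_mul, ← mul_assoc, ← ENNReal.ofReal_ofNat, ← ENNReal.ofReal_mul (by norm_num)]
          congr 2
          ring
  have hdiv : edist (f x) (f 0) ≤ ENNReal.ofReal (4 * ρ) * K * (I * (μ S)⁻¹) ^ (1 / q) := by
    have hpow : μ S ^ (1 - 1 / q) = μ S * (μ S)⁻¹ ^ (1 / q) := by
      rw [ENNReal.rpow_sub _ _ hS0 hSt, ENNReal.rpow_one, ENNReal.inv_rpow, div_eq_mul_inv]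
    rw [hpow] at hsum
    have : μ S * edist (f x) (f 0) ≤
        μ S * (ENNReal.ofReal (4 * ρ) * K * (I * (μ S)⁻¹) ^ (1 / q)) := by
      refine hsum.trans (le_of_eq ?_)
      rw [ENNReal.mul_rpow_of_nonneg _ _ (by positivity)]
      ring
    exact (ENNReal.mul_le_mul_iff_right hS0 hSt).1 this
  calc edist (f x) (f 0) ^ q ≤ (ENNReal.ofReal (4 * ρ) * K * (I * (μ S)⁻¹) ^ (1 / q)) ^ q := by
        gcongr
    _ = _ := by
        rw [ENNReal.mul_rpow_of_nonneg _ _ hq0.le, ← ENNReal.rpow_mul, one_div,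
          inv_mul_cancel₀ hq0.ne', ENNReal.rpow_one, mul_comm I]

omit [MeasurableSpace E] [BorelSpace E] in
/-- Mean value inequality along segments, for a `C¹` map. -/
theorem edist_le_lintegral_fderiv {f : E → E} (hf : Differentiable ℝ f)
    (hf' : Continuous (fderiv ℝ f)) (x y : E) :
    edist (f x) (f y) ≤
      edist x y * ∫⁻ s in Set.Ioc (0 : ℝ) 1, ‖fderiv ℝ f (x + s • (y - x))‖ₑ := by
  have hderiv : ∀ s ∈ Set.uIcc (0 : ℝ) 1, HasDerivAt (fun s : ℝ => f (x + s • (y - x)))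
      (fderiv ℝ f (x + s • (y - x)) (y - x)) s := by
    intro s _
    have h1 : HasDerivAt (fun s : ℝ => x + s • (y - x)) (y - x) s := by
      simpa using ((hasDerivAt_id s).smul_const (y - x)).const_add x
    exact (hf _).hasFDerivAt.comp_hasDerivAt s h1
  have hcont : Continuous fun s : ℝ => fderiv ℝ f (x + s • (y - x)) (y - x) := by fun_prop
  have h := intervalIntegral.integral_eq_sub_of_hasDerivAt hderiv (hcont.intervalIntegrable 0 1)
  simp only [one_smul, zero_smul, add_zero, add_sub_cancel] at h
  rw [intervalIntegral.integral_of_le zero_le_one] at h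
  rw [edist_comm, edist_eq_enorm_sub, ← h]
  refine (enorm_integral_le_lintegral_enorm _).trans ?_
  rw [edist_comm, edist_eq_enorm_sub, ← lintegral_const_mul' _ _ (by simp)]
  refine lintegral_mono fun s => ?_
  rw [mul_comm]
  exact ContinuousLinearMap.le_opENorm _ _

end Morrey

/-! ### The derivative norm as a measurable functional of the map. -/

section Gradient

variable {E : Type*} [NormedAddCommGroup E] [NormedSpace ℝ E] [SecondCountableTopology E]

/-- The norm of the derivative, as a countable expression in values of the map. -/
noncomputable def gradSup (f : E → E) (x : E) : ℝ≥0∞ :=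
  ⨆ l : ℕ, limsup (fun n : ℕ =>
    ‖((n : ℝ) + 1) • (f (x + ((n : ℝ) + 1)⁻¹ • unitSeq E l) - f x)‖ₑ) atTop

theorem gradSup_eq {f : E → E} {x : E} (hf : DifferentiableAt ℝ f x) :
    gradSup f x = ‖fderiv ℝ f x‖ₑ := by
  have hlim : ∀ l : ℕ, limsup (fun n : ℕ =>
      ‖((n : ℝ) + 1) • (f (x + ((n : ℝ) + 1)⁻¹ • unitSeq E l) - f x)‖ₑ) atTop =
      ‖fderiv ℝ f x (unitSeq E l)‖ₑ := by
    intro l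
    refine Tendsto.limsup_eq (Tendsto.enorm ?_)
    exact (hf.hasFDerivAt.lim_real (unitSeq E l)).comp
      (tendsto_atTop_add_const_right _ 1 tendsto_natCast_atTop_atTop)
  simp only [gradSup, hlim]
  refine le_antisymm (iSup_le fun l => ?_) ?_
  · refine (ContinuousLinearMap.le_opENorm _ _).trans (mul_le_of_le_one_right' ?_)
    rw [← ofReal_norm, ENNReal.ofReal_le_one]
    exact norm_unitSeq_le l
  · set C := ⨆ l, ‖fderiv ℝ f x (unitSeq E l)‖ₑ with hC
    rcases eq_or_ne C ∞ with h | h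
    · rw [h]; exact le_top
    · have hclosed : IsClosed {v : E | ‖fderiv ℝ f x v‖ ≤ C.toReal} :=
        isClosed_le (by fun_prop) continuous_const
      have hle : ‖fderiv ℝ f x‖ ≤ C.toReal := by
        refine ContinuousLinearMap.opNorm_le_of_unit_norm ENNReal.toReal_nonneg fun v hv => ?_
        refine unitSeq_induction hclosed (fun n => ?_) hv.le
        have h1 : ‖fderiv ℝ f x (unitSeq E n)‖ₑ ≤ C :=
          le_iSup (fun l => ‖fderiv ℝ f x (unitSeq E l)‖ₑ) n
        have h2 := ENNReal.toReal_mono h h1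
        rwa [toReal_enorm] at h2
      rw [← ofReal_norm, ← ENNReal.ofReal_toReal h]
      exact ENNReal.ofReal_le_ofReal hle

theorem gradSup_shift (f : E → E) (a : E) :
    gradSup (fun x => f (x + a) - a) 0 = gradSup f a := by
  simp only [gradSup, sub_sub_sub_cancel_right, zero_add, add_comm _ a, add_zero]

variable [MeasurableSpace E] [BorelSpace E]

/-- This is why `gradSup` replaces `fderiv`: a limsup over countably many directions is measurable
on the whole function space, so equality in law applies to it. -/
theorem measurable_gradSup (x : E) : Measurable fun f : E → E => gradSup f x := by
  refine Measurable.iSup fun l => Measurable.limsup fun n => ?_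
  have hev : ∀ x : E, Measurable fun f : E → E => f x := fun x => measurable_pi_apply x
  exact (((hev _).sub (hev _)).const_smul _).enorm

theorem Measurable.gradSup {α : Type*} [MeasurableSpace α] {f : α → ContSelfMap E} {x : α → E}
    (hf : Measurable f) (hx : Measurable x) : Measurable fun a => gradSup (f a).1 (x a) := by
  refine Measurable.iSup fun l => Measurable.limsup fun n => ?_
  exact (((hf.eval_contSelfMap (hx.add_const _)).sub (hf.eval_contSelfMap hx)).const_smul _).enorm

/-- Morrey's inequality for the oscillation of a family of `C¹` maps. -/
theorem iSup_osc_rpow_le [FiniteDimensional ℝ E] (μ : Measure E) [μ.IsAddHaarMeasure]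
    {f : ℕ → E → E} (hf : ∀ k, Differentiable ℝ (f k)) (hf' : ∀ k, Continuous (fderiv ℝ (f k)))
    {M : E → ℝ≥0∞} (hM : Measurable M) (hfM : ∀ k x, ‖fderiv ℝ (f k) x‖ₑ ≤ M x)
    {q : ℝ} (hq : 1 < q) {ρ : ℝ} (hρ : 0 < ρ) :
    (⨆ k, osc (f k) 0 ρ) ^ q ≤
      (ENNReal.ofReal (4 * ρ) * morreyConst (Module.finrank ℝ E) q) ^ q *
      ((μ (Metric.closedBall 0 ρ))⁻¹ * ∫⁻ y in Metric.closedBall 0 ρ, M y ^ q ∂μ) := by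
  have hq0 : 0 < q := by linarith
  rw [← ENNReal.le_rpow_inv_iff hq0]
  refine iSup_le fun k => osc_le hρ.le fun z hz => ?_
  rw [ENNReal.le_rpow_inv_iff hq0, zero_add]
  refine edist_zero_rpow_le μ hM (hf k).continuous (fun x y => ?_) hq hρ (by simpa using hz)
  refine (edist_le_lintegral_fderiv (hf k) (hf' k) x y).trans ?_
  gcongr with s
  exact hfM k _

end Gradient

/-! ### Moments of the oscillation through Morrey's inequality. -/

section Flow

variable {d : ℕ} {Ω : Type*} [MeasurableSpace Ω]
  {φ : ℝ≥0 → ℝ≥0 → Ω → EuclideanSpace ℝ (Fin d) → EuclideanSpace ℝ (Fin d)}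
  {P : Measure Ω}

/-- Moments of the derivatives of the flow do not depend on the base point. -/
theorem IsTranslationInvariantBrownianFlow.lintegral_gradSup
    (hφ : IsTranslationInvariantBrownianFlow φ P) (τ : ℕ → ℝ≥0) (q : ℝ)
    (y : EuclideanSpace ℝ (Fin d)) :
    ∫⁻ ω, (⨆ k, gradSup (φ 0 (τ k) ω) y) ^ q ∂P = ∫⁻ ω, (⨆ k, gradSup (φ 0 (τ k) ω) 0) ^ q ∂P := by
  let E := EuclideanSpace ℝ (Fin d)
  let G : ({p : ℝ≥0 × ℝ≥0 // p.1 ≤ p.2} → E → E) → ℝ≥0∞ := fun f =>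
    (⨆ k : ℕ, gradSup (f ⟨(0, τ k), zero_le⟩) 0) ^ q
  have hG : Measurable G := by
    refine Measurable.pow_const ?_ q
    exact Measurable.iSup fun k => (measurable_gradSup 0).comp (measurable_pi_apply _)
  have h := ((hφ.translation_invariant y).comp hG).lintegral_eq
  refine Eq.trans (lintegral_congr fun ω => ?_) h
  exact congrArg (· ^ q) (iSup_congr fun k => (gradSup_shift (φ 0 (τ k) ω) y).symm)

/-- Moment bound for the oscillation of the flow over small balls, uniform in the radius. -/
theorem IsTranslationInvariantBrownianFlow.lintegral_osc_rpow_le [IsProbabilityMeasure P]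
    (hφ : IsTranslationInvariantBrownianFlow φ P)
    (hdiff : ∀ (ω : Ω) (t : ℝ≥0), Differentiable ℝ (φ 0 t ω))
    (hcont : ∀ ω t, Continuous (fderiv ℝ (φ 0 t ω)))
    (τ : ℕ → ℝ≥0) {q : ℝ} (hq : 1 < q) {ρ : ℝ} (hρ : 0 < ρ) :
    ∫⁻ ω, (⨆ k, osc (φ 0 (τ k) ω) 0 ρ) ^ q ∂P ≤ (ENNReal.ofReal (4 * ρ) * morreyConst d q) ^ q *
      ∫⁻ ω, (⨆ k, ‖fderiv ℝ (φ 0 (τ k) ω) 0‖ₑ) ^ q ∂P := by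
  obtain ⟨M, hM⟩ : ∃ M : Ω → EuclideanSpace ℝ (Fin d) → ℝ≥0∞,
    ∀ ω x, M ω x = ⨆ k, gradSup (φ 0 (τ k) ω) x := ⟨_, fun _ _ => rfl⟩
  have hMm : Measurable (Function.uncurry M) := by
    have : Function.uncurry M = fun p => ⨆ k, gradSup (φ 0 (τ k) p.1) p.2 :=
      funext fun p => hM p.1 p.2
    rw [this]
    refine Measurable.iSup fun k => ?_
    have h := ((hφ.measurable_toCont 0 (τ k)).comp
      (measurable_fst (α := Ω) (β := EuclideanSpace ℝ (Fin d)))).gradSup (measurable_snd (α := Ω) (β := EuclideanSpace ℝ (Fin d)))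
    simpa only [Function.comp, hφ.toCont_coe (zero_le (a := τ k))] using h
  have hMx : ∀ ω, Measurable (M ω) := fun ω => hMm.of_uncurry_left
  let S := Metric.closedBall (0 : EuclideanSpace ℝ (Fin d)) ρ
  have hS0 : volume S ≠ 0 := (Metric.measure_closedBall_pos volume 0 hρ).ne'
  have hSt : volume S ≠ ∞ := measure_closedBall_lt_top.ne
  have hpt : ∀ ω, (⨆ k, osc (φ 0 (τ k) ω) 0 ρ) ^ q ≤
      (ENNReal.ofReal (4 * ρ) * morreyConst d q) ^ q *
        ((volume S)⁻¹ * ∫⁻ y in S, M ω y ^ q) := by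
    intro ω
    have h := iSup_osc_rpow_le volume (fun k => hdiff ω (τ k)) (fun k => hcont ω (τ k)) (hMx ω)
      (fun k x => ?_) hq hρ
    · rwa [finrank_euclideanSpace_fin] at h
    · rw [← gradSup_eq (hdiff ω (τ k) _), hM]
      exact le_iSup (fun k => gradSup (φ 0 (τ k) ω) x) k
  have hIm : Measurable fun ω => ∫⁻ y in S, M ω y ^ q :=
    (hMm.pow_const q).lintegral_prod_right'
  have h0 : ∫⁻ ω, (⨆ k, ‖fderiv ℝ (φ 0 (τ k) ω) 0‖ₑ) ^ q ∂P = ∫⁻ ω, M ω 0 ^ q ∂P := by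
    refine lintegral_congr fun ω => ?_
    simp only [hM, gradSup_eq (hdiff ω _ _)]
  calc _ ≤ ∫⁻ ω, (ENNReal.ofReal (4 * ρ) * morreyConst d q) ^ q *
        ((volume S)⁻¹ * (∫⁻ y in S, M ω y ^ q)) ∂P := lintegral_mono hpt
    _ = (ENNReal.ofReal (4 * ρ) * morreyConst d q) ^ q *
        ((volume S)⁻¹ * ∫⁻ ω, (∫⁻ y in S, M ω y ^ q) ∂P) := by
        rw [lintegral_const_mul _ (hIm.const_mul _), lintegral_const_mul _ hIm]
    _ = _ := by
        -- After Fubini the moment at `y` does not depend on `y`, so its average over the ball is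
        -- the moment at `0`.
        rw [lintegral_lintegral_swap (hMm.pow_const q).aemeasurable, h0]
        simp only [hM, hφ.lintegral_gradSup τ q]
        rw [lintegral_const, Measure.restrict_apply_univ, mul_comm (∫⁻ _, _ ∂P), ← mul_assoc,
          ← mul_assoc, mul_assoc _ _ (volume S), ENNReal.inv_mul_cancel hS0 hSt, mul_one]

end Flow

/-! ### One-step moment bound with the sharp exponential rate. -/

/-- A dense sequence in `[0, h]`. -/
noncomputable def timeSeq (h : ℝ≥0) (n : ℕ) : ℝ≥0 :=
  haveI : Nonempty (Set.Iic h) := ⟨⟨h, Set.mem_Iic.2 le_rfl⟩⟩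
  (TopologicalSpace.denseSeq (Set.Iic h) n : ℝ≥0)

theorem timeSeq_le (h : ℝ≥0) (n : ℕ) : timeSeq h n ≤ h := by
  have : Nonempty (Set.Iic h) := ⟨⟨h, Set.mem_Iic.2 le_rfl⟩⟩
  exact (TopologicalSpace.denseSeq (Set.Iic h) n).2

theorem timeSeq_induction {h : ℝ≥0} {S : Set ℝ≥0} (hS : IsClosed S) (hk : ∀ n, timeSeq h n ∈ S)
    {t : ℝ≥0} (ht : t ≤ h) : t ∈ S := by
  have : Nonempty (Set.Iic h) := ⟨⟨h, Set.mem_Iic.2 le_rfl⟩⟩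
  exact DenseRange.induction_on (p := fun w : Set.Iic h => (w : ℝ≥0) ∈ S)
    (TopologicalSpace.denseRange_denseSeq (Set.Iic h)) ⟨t, ht⟩
    (hS.preimage continuous_subtype_val) hk

/-- Hölder against the constant `1`, with exponent `q / p`. The factor `μ B ^ (1 - p / q)` makes the
contribution of a rare event small. -/
theorem setLIntegral_rpow_le {α : Type*} [MeasurableSpace α] {μ : Measure α} {f : α → ℝ≥0∞}
    (hf : AEMeasurable f μ) (B : Set α) {p q : ℝ} (hp : 0 < p) (hpq : p < q) :
    ∫⁻ a in B, f a ^ p ∂μ ≤ (∫⁻ a, f a ^ q ∂μ) ^ (p / q) * μ B ^ (1 - p / q) := by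
  have h1 : 1 < q / p := (one_lt_div hp).2 hpq
  have hconj := Real.HolderConjugate.conjExponent h1
  have h := ENNReal.lintegral_mul_le_Lp_mul_Lq (μ.restrict B) hconj
    (f := fun a => f a ^ p) (g := fun _ => 1) (hf.restrict.pow_const p) aemeasurable_const
  have hexp : 1 / (q / p).conjExponent = 1 - p / q := by
    have := hconj.inv_add_inv_eq_one
    rw [inv_div] at this
    rw [one_div]; linarith
  simp only [Pi.mul_apply, mul_one, ENNReal.one_rpow, lintegral_const,
    Measure.restrict_apply_univ, one_mul, hexp, one_div_div, ← ENNReal.rpow_mul,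
    mul_div_cancel₀ q hp.ne'] at h
  refine h.trans ?_
  gcongr
  · exact div_nonneg hp.le (hp.trans hpq).le
  · exact Measure.restrict_le_self

theorem ENNReal.add_one_rpow_le (a : ℝ≥0∞) {p : ℝ} (hp : 0 < p) :
    (a + 1) ^ p ≤ 2 ^ p * (a ^ p + 1) := by
  calc (a + 1) ^ p ≤ (2 * max a 1) ^ p := by
        gcongr
        rw [two_mul]
        exact add_le_add (le_max_left _ _) (le_max_right _ _)
    _ = 2 ^ p * max a 1 ^ p := ENNReal.mul_rpow_of_nonneg _ _ hp.le
    _ ≤ _ := by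
        gcongr
        rcases le_total a 1 with h | h
        · rw [max_eq_right h, ENNReal.one_rpow]; exact le_add_self
        · rw [max_eq_left h]; exact le_self_add

section Flow

variable {d : ℕ} {Ω : Type*} [MeasurableSpace Ω]
  {φ : ℝ≥0 → ℝ≥0 → Ω → EuclideanSpace ℝ (Fin d) → EuclideanSpace ℝ (Fin d)}
  {P : Measure Ω}

theorem IsStochasticFlow.continuous_uncurry (hφ : IsStochasticFlow φ) (ω : Ω) :
    Continuous fun p : ℝ≥0 × EuclideanSpace ℝ (Fin d) => φ 0 p.1 ω p.2 := by
  have h : Continuous fun p : ℝ≥0 × EuclideanSpace ℝ (Fin d) => ((0 : ℝ≥0), p.1, p.2) := by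
    fun_prop
  exact (hφ.continuousOn ω).comp_continuous h fun p => zero_le (a := p.1)

theorem IsStochasticFlow.osc_le_iSup_timeSeq (hφ : IsStochasticFlow φ) (ω : Ω) {t h : ℝ≥0}
    (ht : t ≤ h) (y : EuclideanSpace ℝ (Fin d)) (ρ : ℝ) :
    osc (φ 0 t ω) y ρ ≤ ⨆ k, osc (φ 0 (timeSeq h k) ω) y ρ := by
  have hc : ∀ x, Continuous fun t : ℝ≥0 => φ 0 t ω x := fun x =>
    (hφ.continuous_uncurry ω).comp (by fun_prop : Continuous fun t : ℝ≥0 => (t, x))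
  refine iSup_le fun n => ?_
  have hclosed : IsClosed {t : ℝ≥0 | edist (φ 0 t ω (y + ρ • unitSeq _ n)) (φ 0 t ω y) ≤
      ⨆ k, osc (φ 0 (timeSeq h k) ω) y ρ} :=
    isClosed_le ((hc _).edist (hc _)) continuous_const
  refine timeSeq_induction hclosed (fun k => ?_) ht
  exact (le_iSup (fun n => edist (φ 0 (timeSeq h k) ω (y + ρ • unitSeq _ n))
    (φ 0 (timeSeq h k) ω y)) n).trans (le_iSup (fun k => osc (φ 0 (timeSeq h k) ω) y ρ) k)

theorem IsStochasticFlow.measurable_iSup_osc (hφ : IsStochasticFlow φ) (τ : ℕ → ℝ≥0)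
    (y : EuclideanSpace ℝ (Fin d)) (ρ : ℝ) :
    Measurable fun ω => ⨆ k, osc (φ 0 (τ k) ω) y ρ := by
  refine Measurable.iSup fun k => ?_
  have := (hφ.measurable_toCont 0 (τ k)).osc (measurable_const (a := y)) (measurable_const (a := ρ))
  simpa only [hφ.toCont_coe (zero_le (a := τ k))] using this

theorem IsStochasticFlow.measurable_iSup_enorm_fderiv (hφ : IsStochasticFlow φ)
    (hdiff : ∀ (ω : Ω) (t : ℝ≥0), Differentiable ℝ (φ 0 t ω)) (τ : ℕ → ℝ≥0)
    (y : EuclideanSpace ℝ (Fin d)) :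
    Measurable fun ω => ⨆ k, ‖fderiv ℝ (φ 0 (τ k) ω) y‖ₑ := by
  refine Measurable.iSup fun k => ?_
  have := (hφ.measurable_toCont 0 (τ k)).gradSup (measurable_const (a := y))
  simp only [hφ.toCont_coe (zero_le (a := τ k))] at this
  simpa only [gradSup_eq (hdiff _ _ _)] using this

omit [MeasurableSpace Ω] in
/-- Over small balls the flow up to time `h` expands by at most a little more than its
derivative at the centre does. -/
theorem eventually_iSup_osc_le (ω : Ω)
    (hdiff : ∀ (t : ℝ≥0), Differentiable ℝ (φ 0 t ω))
    (hcont : Continuous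
      (fun p : ℝ≥0 × EuclideanSpace ℝ (Fin d) => fderiv ℝ (φ 0 p.1 ω) p.2)) (h : ℝ≥0) :
    ∀ᶠ ρ : ℝ in 𝓝[>] 0, (⨆ k, osc (φ 0 (timeSeq h k) ω) 0 ρ) ≤
      ENNReal.ofReal ρ * ((⨆ k, ‖fderiv ℝ (φ 0 (timeSeq h k) ω) 0‖ₑ) + 1) := by
  set D := ⨆ k, ‖fderiv ℝ (φ 0 (timeSeq h k) ω) 0‖ₑ with hD
  rcases eq_or_ne D ∞ with htop | hfin
  · filter_upwards [self_mem_nhdsWithin] with ρ hρ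
    have hρ' : ENNReal.ofReal ρ ≠ 0 := by simpa using hρ
    rw [htop, top_add, ENNReal.mul_top hρ']
    exact le_top
  · have hDt : ∀ t ∈ Set.Iic h, ‖fderiv ℝ (φ 0 t ω) 0‖ₑ ≤ D := by
      intro t ht
      have hclosed : IsClosed {t : ℝ≥0 | ‖fderiv ℝ (φ 0 t ω) 0‖ₑ ≤ D} :=
        isClosed_le ((hcont.comp (by fun_prop : Continuous fun t : ℝ≥0 =>
          (t, (0 : EuclideanSpace ℝ (Fin d))))).enorm) continuous_const
      exact timeSeq_induction hclosed
        (fun k => le_iSup (fun k => ‖fderiv ℝ (φ 0 (timeSeq h k) ω) 0‖ₑ) k) ht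
    have hU : IsOpen {p : ℝ≥0 × EuclideanSpace ℝ (Fin d) | ‖fderiv ℝ (φ 0 p.1 ω) p.2‖ₑ < D + 1} :=
      isOpen_lt hcont.enorm continuous_const
    have hcompact : IsCompact (Set.Iic h) := by
      rw [← Set.Icc_bot]; exact isCompact_Icc
    -- Compactness of `[0, h]` gives one neighbourhood of `0` on which `D + 1` bounds the derivative
    -- at all times.
    obtain ⟨u, v, -, hv, hu, h0, huv⟩ := generalized_tube_lemma hcompact
      (isCompact_singleton (x := (0 : EuclideanSpace ℝ (Fin d)))) hU (by
        rintro ⟨t, x⟩ ⟨ht, hx⟩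
        obtain rfl : x = 0 := hx
        exact (hDt t ht).trans_lt (ENNReal.lt_add_right hfin one_ne_zero))
    obtain ⟨ε, hε, hball⟩ := Metric.isOpen_iff.1 hv 0 (h0 rfl)
    have hfin1 : D + 1 ≠ ∞ := ENNReal.add_ne_top.2 ⟨hfin, ENNReal.one_ne_top⟩
    filter_upwards [Ioo_mem_nhdsGT hε] with ρ hρ
    refine iSup_le fun k => osc_le hρ.1.le fun z hz => ?_
    have hbd : ∀ x ∈ Metric.ball (0 : EuclideanSpace ℝ (Fin d)) ε,
        ‖fderiv ℝ (φ 0 (timeSeq h k) ω) x‖ ≤ (D + 1).toReal := by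
      intro x hx
      have hlt := huv (Set.mk_mem_prod (hu (timeSeq_le h k)) (hball hx))
      rw [Set.mem_ofPred_eq] at hlt
      rw [← toReal_enorm]
      exact ENNReal.toReal_mono hfin1 hlt.le
    have hz' : z ∈ Metric.ball (0 : EuclideanSpace ℝ (Fin d)) ε := by
      rw [mem_ball_zero_iff]; exact hz.trans_lt hρ.2
    have key := (convex_ball (0 : EuclideanSpace ℝ (Fin d)) ε).norm_image_sub_le_of_norm_fderiv_le
      (fun x _ => (hdiff (timeSeq h k)) x) hbd (Metric.mem_ball_self hε) hz'
    rw [zero_add, edist_dist, dist_eq_norm, ← ENNReal.ofReal_toReal hfin1,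
      ← ENNReal.ofReal_mul hρ.1.le]
    refine ENNReal.ofReal_le_ofReal (key.trans ?_)
    rw [sub_zero, mul_comm]
    gcongr

/-- Moment bound for the oscillation over one time step from a small ball: the constant is
essentially the moment of the derivative. -/
theorem IsTranslationInvariantBrownianFlow.exists_lintegral_osc_le [IsProbabilityMeasure P]
    (hφ : IsTranslationInvariantBrownianFlow φ P)
    (hdiff : ∀ (ω : Ω) (t : ℝ≥0), Differentiable ℝ (φ 0 t ω))
    (hcont : ∀ ω : Ω, Continuous
      (fun p : ℝ≥0 × EuclideanSpace ℝ (Fin d) => fderiv ℝ (φ 0 p.1 ω) p.2)) (h : ℝ≥0)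
    {p q : ℝ} (hp : 0 < p) (hpq : p < q) (hq : 1 < q) (hdq : d < q)
    (hmom : ∫⁻ ω, (⨆ k, ‖fderiv ℝ (φ 0 (timeSeq h k) ω) 0‖ₑ) ^ q ∂P ≠ ∞)
    {u : ℝ≥0} (hu : 0 < u) :
    ∃ ρ₀ : ℝ≥0, 0 < ρ₀ ∧ ρ₀ < u ∧ ∀ ρ : ℝ≥0, ρ ≤ ρ₀ →
      ∫⁻ ω, (⨆ k, osc (φ 0 (timeSeq h k) ω) 0 ρ) ^ p ∂P ≤
        (2 ^ p * (∫⁻ ω, (⨆ k, ‖fderiv ℝ (φ 0 (timeSeq h k) ω) 0‖ₑ) ^ p ∂P + 1) + 1) *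
          (ρ : ℝ≥0∞) ^ p := by
  have hq0 : 0 < q := by linarith
  set D : Ω → ℝ≥0∞ := fun ω => ⨆ k, ‖fderiv ℝ (φ 0 (timeSeq h k) ω) 0‖ₑ
  set O : ℝ → Ω → ℝ≥0∞ := fun ρ ω => ⨆ k, osc (φ 0 (timeSeq h k) ω) 0 ρ
  have hDm : Measurable D := hφ.measurable_iSup_enorm_fderiv hdiff _ 0
  have hOm : ∀ ρ, Measurable (O ρ) := fun ρ => hφ.measurable_iSup_osc _ 0 ρ
  -- The bad event. By `eventually_iSup_osc_le` each `ω` lies outside `B ρ` for all small `ρ`, hence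
  -- `P (B ρ) → 0`.
  let B : ℝ → Set Ω := fun ρ => {ω | ENNReal.ofReal ρ * (D ω + 1) < O ρ ω}
  have hBm : ∀ ρ, MeasurableSet (B ρ) := fun ρ =>
    measurableSet_lt (measurable_const.mul (hDm.add measurable_const)) (hOm ρ)
  have hB : Tendsto (fun ρ => P (B ρ)) (𝓝[>] 0) (𝓝 0) := by
    have := tendsto_measure_of_ae_tendsto_indicator_of_isFiniteMeasure (𝓝[>] (0 : ℝ))
      (μ := P) (As := B) (A := ∅) MeasurableSet.empty hBm (ae_of_all _ fun ω => by
        filter_upwards [eventually_iSup_osc_le ω (hdiff ω) (hcont ω) h] with ρ hρ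
        simpa [B, O, D] using hρ)
    simpa only [measure_empty] using this
  -- Morrey and Hölder bound the bad part by `ρ ^ p * C * P (B ρ) ^ (1 - p / q)`. Only finiteness of
  -- `C` matters, since small `ρ` brings the last two factors below `1`.
  set C : ℝ≥0∞ := (4 * morreyConst d q) ^ p * (∫⁻ ω, D ω ^ q ∂P) ^ (p / q) with hC
  have hCt : C ≠ ∞ := by
    refine ENNReal.mul_ne_top ?_ ?_
    · exact ENNReal.rpow_ne_top_of_nonneg hp.le
        (ENNReal.mul_ne_top (by simp) (morreyConst_ne_top hq0 hdq))
    · exact ENNReal.rpow_ne_top_of_nonneg (div_nonneg hp.le hq0.le) hmom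
  have hθ : 0 < 1 - p / q := by rw [sub_pos, div_lt_one hq0]; exact hpq
  have hlim : Tendsto (fun ρ => C * P (B ρ) ^ (1 - p / q)) (𝓝[>] 0) (𝓝 0) := by
    have h1 := ENNReal.Tendsto.const_mul (a := C)
      ((ENNReal.continuous_rpow_const (y := 1 - p / q)).tendsto 0 |>.comp hB) (Or.inr hCt)
    rwa [ENNReal.zero_rpow_of_pos hθ, mul_zero] at h1
  have hev : ∀ᶠ ρ in 𝓝[>] 0, C * P (B ρ) ^ (1 - p / q) ≤ 1 :=
    hlim.eventually_le_const one_pos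
  obtain ⟨ε, hε, hsmall⟩ := mem_nhdsGT_iff_exists_Ioo_subset.1 hev
  have hε' : (0 : ℝ) < ε := hε
  refine ⟨min (u / 2) (ε / 2).toNNReal, ?_, ?_, ?_⟩
  · refine lt_min (half_pos hu) ?_
    exact Real.toNNReal_pos.2 (half_pos hε')
  · exact (min_le_left _ _).trans_lt (NNReal.half_lt_self hu.ne')
  intro ρ hρ
  rcases eq_or_ne ρ 0 with rfl | hρ0
  · simp [osc, ENNReal.zero_rpow_of_pos hp]
  have hρpos : (0 : ℝ) < ρ := by positivity
  have hρε : (ρ : ℝ) < ε := by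
    have h2 : (ρ : ℝ) ≤ ε / 2 :=
      (Real.le_toNNReal_iff_coe_le (half_pos hε').le).1 (hρ.trans (min_le_right _ _))
    linarith
  have hC1 : C * P (B ρ) ^ (1 - p / q) ≤ 1 := hsmall ⟨hρpos, hρε⟩
  have hgood : ∫⁻ ω in (B ρ)ᶜ, O ρ ω ^ p ∂P ≤
      (ρ : ℝ≥0∞) ^ p * (2 ^ p * (∫⁻ ω, D ω ^ p ∂P + 1)) := by
    calc _ ≤ ∫⁻ ω in (B ρ)ᶜ, (ρ : ℝ≥0∞) ^ p * (2 ^ p * (D ω ^ p + 1)) ∂P := by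
          refine setLIntegral_mono' (hBm ρ).compl fun ω hω => ?_
          have h1 : O ρ ω ≤ ρ * (D ω + 1) := by
            simpa [B] using hω
          calc O ρ ω ^ p ≤ (ρ * (D ω + 1)) ^ p := by gcongr
            _ = ρ ^ p * (D ω + 1) ^ p := ENNReal.mul_rpow_of_nonneg _ _ hp.le
            _ ≤ _ := by gcongr; exact ENNReal.add_one_rpow_le _ hp
      _ ≤ ∫⁻ ω, (ρ : ℝ≥0∞) ^ p * (2 ^ p * (D ω ^ p + 1)) ∂P := setLIntegral_le_lintegral _ _
      _ = _ := by
          rw [lintegral_const_mul _ (by fun_prop), lintegral_const_mul _ (by fun_prop),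
            lintegral_add_right _ measurable_const, lintegral_const, measure_univ, one_mul]
  have hbad : ∫⁻ ω in B ρ, O ρ ω ^ p ∂P ≤ (ρ : ℝ≥0∞) ^ p := by
    refine (setLIntegral_rpow_le (hOm ρ).aemeasurable (B ρ) hp hpq).trans ?_
    have h1 := hφ.lintegral_osc_rpow_le hdiff
      (fun ω t => (hcont ω).comp (by fun_prop : Continuous fun x => (t, x)))
      (timeSeq h) hq hρpos
    have h2 : (∫⁻ ω, O ρ ω ^ q ∂P) ^ (p / q) ≤ (ρ : ℝ≥0∞) ^ p * C := by
      calc _ ≤ ((ENNReal.ofReal (4 * ρ) * morreyConst d q) ^ q * ∫⁻ ω, D ω ^ q ∂P) ^ (p / q) :=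
            ENNReal.rpow_le_rpow h1 (div_nonneg hp.le hq0.le)
        _ = _ := by
            rw [ENNReal.mul_rpow_of_nonneg _ _ (div_nonneg hp.le hq0.le), ← ENNReal.rpow_mul,
              mul_div_cancel₀ p hq0.ne', ENNReal.ofReal_mul (by norm_num), hC,
              ENNReal.ofReal_coe_nnreal, ENNReal.ofReal_ofNat, mul_comm (4 : ℝ≥0∞), mul_assoc,
              ENNReal.mul_rpow_of_nonneg _ _ hp.le, mul_assoc]
    calc _ ≤ (ρ : ℝ≥0∞) ^ p * C * P (B ρ) ^ (1 - p / q) := by gcongr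
      _ = (ρ : ℝ≥0∞) ^ p * (C * P (B ρ) ^ (1 - p / q)) := mul_assoc _ _ _
      _ ≤ _ := mul_le_of_le_one_right' hC1
  change ∫⁻ ω, O ρ ω ^ p ∂P ≤ _
  rw [← lintegral_add_compl _ (hBm ρ)]
  calc _ ≤ (ρ : ℝ≥0∞) ^ p + (ρ : ℝ≥0∞) ^ p * (2 ^ p * (∫⁻ ω, D ω ^ p ∂P + 1)) :=
        add_le_add hbad hgood
    _ = _ := by ring

/-- Moments of the derivative of the flow, from the domination by the running maximum of a
Brownian motion with drift. -/
theorem lintegral_iSup_enorm_fderiv_rpow_le {W : ℝ≥0 → Ω → ℝ} (hW : IsBrownianReal W P)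
    {c Λ σ : ℝ} (hc : 1 ≤ c) (hΛ : 0 ≤ Λ) (hσ : 0 < σ)
    (hbound : ∀ T : ℝ≥0, ∀ᵐ ω ∂P,
      ‖fderiv ℝ (φ 0 T ω) 0‖ ≤ c * Real.exp (⨆ s : Set.Icc (0 : ℝ≥0) T, (Λ * s + σ * W s ω)))
    {p b : ℝ} (hp : 0 < p) (hb : p * σ < b) {h : ℝ≥0} (hh : 0 < h) :
    ∫⁻ ω, (⨆ k, ‖fderiv ℝ (φ 0 (timeSeq h k) ω) 0‖ₑ) ^ p ∂P ≤
      ENNReal.ofReal (c ^ p * (1 + Real.exp (p * σ) / (1 - Real.exp (p * σ - b))) *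
        Real.exp ((p * Λ + b ^ 2 / 2) * h)) := by
  have hc0 : 0 < c := by linarith
  obtain ⟨Z, hZm, hZ, hZint⟩ := exists_exp_brownian_le hW (mul_pos hp hσ).le hb hh
  -- The exceptional null set depends on the time, hence the countable family `timeSeq`.
  have hae : ∀ᵐ ω ∂P, ∀ k, ‖fderiv ℝ (φ 0 (timeSeq h k) ω) 0‖ ≤
      c * Real.exp (⨆ s : Set.Icc (0 : ℝ≥0) (timeSeq h k), (Λ * s + σ * W s ω)) :=
    ae_all_iff.2 fun k => hbound _
  have hpos : 0 < c ^ p * Real.exp (p * Λ * h) := by positivity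
  calc _ ≤ ∫⁻ ω, ENNReal.ofReal (c ^ p * Real.exp (p * Λ * h)) * Z ω ∂P := by
        refine lintegral_mono_ae ?_
        filter_upwards [hae] with ω hω
        rcases eq_or_ne (Z ω) ∞ with htop | hfin
        · rw [htop, ENNReal.mul_top (by simpa using hpos)]
          exact le_top
        rw [← ENNReal.le_rpow_inv_iff hp]
        refine iSup_le fun k => ?_
        rw [ENNReal.le_rpow_inv_iff hp]
        have hz : ∀ s ≤ h, Real.exp (p * σ * W s ω) ≤ (Z ω).toReal := fun s hs => by
          have := ENNReal.toReal_mono hfin (hZ ω s hs)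
          rwa [ENNReal.toReal_ofReal (Real.exp_pos _).le] at this
        have hz0 : 0 < (Z ω).toReal := (Real.exp_pos _).trans_le (hz 0 zero_le)
        have hsup : (⨆ s : Set.Icc (0 : ℝ≥0) (timeSeq h k), (Λ * s + σ * W s ω)) ≤
            Λ * h + Real.log (Z ω).toReal / p := by
          have : Nonempty (Set.Icc (0 : ℝ≥0) (timeSeq h k)) := ⟨⟨0, le_rfl, zero_le⟩⟩
          refine ciSup_le fun s => ?_
          have hs : (s : ℝ≥0) ≤ h := s.2.2.trans (timeSeq_le h k)
          have h1 : p * σ * W s ω ≤ Real.log (Z ω).toReal :=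
            (Real.le_log_iff_exp_le hz0).2 (hz s hs)
          have h2 : σ * W s ω ≤ Real.log (Z ω).toReal / p := by
            rw [le_div_iff₀ hp]; linarith
          have h3 : (s : ℝ≥0).1 ≤ h.1 := hs
          have h4 : Λ * (s : ℝ≥0).1 ≤ Λ * h.1 := by gcongr
          exact add_le_add h4 h2
        have hD : ‖fderiv ℝ (φ 0 (timeSeq h k) ω) 0‖ ^ p ≤
            c ^ p * Real.exp (p * Λ * h) * (Z ω).toReal := by
          calc _ ≤ (c * Real.exp (Λ * h + Real.log (Z ω).toReal / p)) ^ p := by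
                refine Real.rpow_le_rpow (norm_nonneg _) ((hω k).trans ?_) hp.le
                gcongr
            _ = _ := by
                rw [Real.mul_rpow hc0.le (Real.exp_pos _).le, ← Real.exp_mul, add_mul,
                  div_mul_cancel₀ _ hp.ne', Real.exp_add, Real.exp_log hz0]
                ring_nf
        rw [← ofReal_norm, ENNReal.ofReal_rpow_of_nonneg (norm_nonneg _) hp.le,
          ← ENNReal.ofReal_toReal hfin, ← ENNReal.ofReal_mul hpos.le]
        exact ENNReal.ofReal_le_ofReal hD
    _ = ENNReal.ofReal (c ^ p * Real.exp (p * Λ * h)) * ∫⁻ ω, Z ω ∂P :=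
        lintegral_const_mul _ hZm
    _ ≤ _ := by
        refine (mul_le_mul_right hZint _).trans (le_of_eq ?_)
        rw [← ENNReal.ofReal_mul hpos.le]
        congr 1
        have : (p * Λ + b ^ 2 / 2) * h = p * Λ * h + b ^ 2 * h / 2 := by ring
        rw [this, Real.exp_add]
        ring

end Flow

/-! ### Iteration over time steps and Chebyshev's inequality. -/

section Flow

variable {d : ℕ} {Ω : Type*} [MeasurableSpace Ω]
  {φ : ℝ≥0 → ℝ≥0 → Ω → EuclideanSpace ℝ (Fin d) → EuclideanSpace ℝ (Fin d)}
  {P : Measure Ω}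

theorem sum_range_pow_succ_le {m : ℝ≥0∞} (hm : 2 ≤ m) (n : ℕ) :
    ∑ k ∈ Finset.range n, m ^ (k + 1) ≤ m ^ (n + 1) := by
  induction n with
  | zero => simp
  | succ n ih =>
    rw [Finset.sum_range_succ]
    calc _ ≤ m ^ (n + 1) + m ^ (n + 1) := by gcongr
      _ = 2 * m ^ (n + 1) := (two_mul _).symm
      _ ≤ m * m ^ (n + 1) := by gcongr
      _ = _ := (pow_succ' _ _).symm

/-- Probability that a small ball has grown to size `ρ₀` at some point of a time grid. -/
theorem IsTranslationInvariantBrownianFlow.measure_grid_osc_ge_le [IsProbabilityMeasure P]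
    (hφ : IsTranslationInvariantBrownianFlow φ P) {h : ℝ≥0} {p : ℝ} (hp : 0 < p)
    {m : ℝ≥0∞} (hm : 2 ≤ m) {ρ₀ : ℝ≥0}
    (hstep : ∀ ρ : ℝ≥0, ρ ≤ ρ₀ →
      ∫⁻ ω, (⨆ k, osc (φ 0 (timeSeq h k) ω) 0 ρ) ^ p ∂P ≤ m * (ρ : ℝ≥0∞) ^ p)
    {r : ℝ} (hr : 0 ≤ r) {N n : ℕ} (hN : 0 < N) (hn : 0 < n) :
    (ρ₀ : ℝ≥0∞) ^ p * P {ω | ∃ j ≤ n * N, (ρ₀ : ℝ≥0∞) ≤ osc (φ 0 (j * (h / N)) ω) 0 r} ≤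
      m ^ (n + 1) * ENNReal.ofReal r ^ p := by
  have hN' : (0 : ℝ≥0) < N := by exact_mod_cast hN
  have hNh : (N : ℝ≥0) * (h / N) = h := mul_div_cancel₀ _ hN'.ne'
  set S : ℕ → Ω → ℝ≥0∞ := fun k ω =>
    min (⨆ i : ℕ, ⨆ _ : i ≤ N, osc (φ 0 (k * h + i * (h / N)) ω) 0 r) ρ₀ with hS
  set a : ℕ → ℝ≥0∞ := fun k => ∫⁻ ω, (min (osc (φ 0 (k * h) ω) 0 r) ρ₀) ^ p ∂P with ha
  have hSa : ∀ k, ∫⁻ ω, S k ω ^ p ∂P ≤ m * a k := by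
    intro k
    refine hφ.lintegral_osc_step_le (k * h) (h / N) N hp (one_le_two.trans hm) (fun ρ hρ => ?_) hr
    refine (lintegral_mono fun ω => ?_).trans (hstep ρ hρ)
    refine ENNReal.rpow_le_rpow (iSup₂_le fun i hi => hφ.osc_le_iSup_timeSeq ω ?_ 0 ρ) hp.le
    calc (i : ℝ≥0) * (h / N) ≤ N * (h / N) := by gcongr
      _ = h := hNh
  have hak : ∀ k, a k ≤ m ^ k * ENNReal.ofReal r ^ p := by
    intro k
    induction k with
    | zero =>
      have h0 : ∀ ω, osc (φ 0 0 ω) 0 r ≤ ENNReal.ofReal r := fun ω => osc_le hr fun z hz => by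
        rw [hφ.self_apply, hφ.self_apply, zero_add, edist_dist, dist_zero_right]
        exact ENNReal.ofReal_le_ofReal hz
      calc a 0 ≤ ∫⁻ _, ENNReal.ofReal r ^ p ∂P := by
            refine lintegral_mono fun ω => ENNReal.rpow_le_rpow ((min_le_left _ _).trans ?_) hp.le
            simpa using h0 ω
        _ = _ := by simp
    | succ k ih =>
      calc a (k + 1) ≤ ∫⁻ ω, S k ω ^ p ∂P := by
            refine lintegral_mono fun ω => ENNReal.rpow_le_rpow (min_le_min_right _ ?_) hp.le
            refine le_trans (le_of_eq ?_)
              (le_iSup₂ (f := fun (i : ℕ) (_ : i ≤ N) =>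
                osc (φ 0 (k * h + i * (h / N)) ω) 0 r) N le_rfl)
            rw [hNh]
            push_cast
            rw [add_mul, one_mul]
        _ ≤ m * a k := hSa k
        _ ≤ m * (m ^ k * ENNReal.ofReal r ^ p) := by gcongr
        _ = _ := by rw [pow_succ', mul_assoc]
  have hSm : ∀ k, Measurable (S k) := by
    intro k
    refine Measurable.min (Measurable.iSup fun i => Measurable.iSup fun _ => ?_) measurable_const
    have := (hφ.measurable_toCont 0 (k * h + i * (h / N))).osc
      (measurable_const (a := (0 : EuclideanSpace ℝ (Fin d)))) (measurable_const (a := r))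
    simpa only [hφ.toCont_coe (zero_le (a := (k : ℝ≥0) * h + i * (h / N)))] using this
  have hsub : {ω | ∃ j ≤ n * N, (ρ₀ : ℝ≥0∞) ≤ osc (φ 0 (j * (h / N)) ω) 0 r} ⊆
      ⋃ k ∈ Finset.range n, {ω | (ρ₀ : ℝ≥0∞) ^ p ≤ S k ω ^ p} := by
    rintro ω ⟨j, hj, hω⟩
    -- The endpoint `j = n * N` falls in the last block as `i = N`, hence `i ≤ N` rather than `i <
    -- N`.
    obtain ⟨k, i, hk, hi, rfl⟩ : ∃ k i, k < n ∧ i ≤ N ∧ j = k * N + i := by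
      rcases hj.eq_or_lt with rfl | hlt
      · refine ⟨n - 1, N, by omega, le_rfl, ?_⟩
        obtain ⟨n, rfl⟩ := Nat.exists_eq_succ_of_ne_zero hn.ne'
        simp [Nat.succ_mul]
      · refine ⟨j / N, j % N, (Nat.div_lt_iff_lt_mul hN).2 hlt, (Nat.mod_lt _ hN).le, ?_⟩
        rw [mul_comm]
        exact (Nat.div_add_mod j N).symm
    simp only [Set.mem_iUnion, Finset.mem_range]
    refine ⟨k, hk, ENNReal.rpow_le_rpow (le_min (hω.trans ?_) le_rfl) hp.le⟩
    refine le_trans (le_of_eq ?_) (le_iSup₂ (f := fun (i : ℕ) (_ : i ≤ N) =>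
      osc (φ 0 (k * h + i * (h / N)) ω) 0 r) i hi)
    congr 3
    push_cast
    rw [add_mul, mul_assoc, hNh]
  calc _ ≤ (ρ₀ : ℝ≥0∞) ^ p * ∑ k ∈ Finset.range n, P {ω | (ρ₀ : ℝ≥0∞) ^ p ≤ S k ω ^ p} := by
        gcongr
        exact (measure_mono hsub).trans (measure_biUnion_finset_le _ _)
    _ = ∑ k ∈ Finset.range n, (ρ₀ : ℝ≥0∞) ^ p * P {ω | (ρ₀ : ℝ≥0∞) ^ p ≤ S k ω ^ p} :=
        Finset.mul_sum _ _ _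
    _ ≤ ∑ k ∈ Finset.range n, m ^ (k + 1) * ENNReal.ofReal r ^ p := by
        refine Finset.sum_le_sum fun k _ => ?_
        refine (mul_meas_ge_le_lintegral ((hSm k).pow_const p) _).trans ((hSa k).trans ?_)
        calc m * a k ≤ m * (m ^ k * ENNReal.ofReal r ^ p) := by gcongr; exact hak k
          _ = _ := by rw [pow_succ', mul_assoc]
    _ = (∑ k ∈ Finset.range n, m ^ (k + 1)) * ENNReal.ofReal r ^ p := (Finset.sum_mul _ _ _).symm
    _ ≤ _ := by gcongr; exact sum_range_pow_succ_le hm n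

/-- Probability that a small ball grows to macroscopic size by time `n h`. -/
theorem IsTranslationInvariantBrownianFlow.measure_iSup_edist_ge_le [IsProbabilityMeasure P]
    (hφ : IsTranslationInvariantBrownianFlow φ P) {h : ℝ≥0} (hh : 0 < h) {p : ℝ} (hp : 0 < p)
    {m : ℝ≥0∞} (hm : 2 ≤ m) {ρ₀ : ℝ≥0} (hρ₀ : 0 < ρ₀)
    (hstep : ∀ ρ : ℝ≥0, ρ ≤ ρ₀ →
      ∫⁻ ω, (⨆ k, osc (φ 0 (timeSeq h k) ω) 0 ρ) ^ p ∂P ≤ m * (ρ : ℝ≥0∞) ^ p)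
    {r : ℝ} (hr : 0 ≤ r) {u : ℝ≥0∞} (hu : ρ₀ < u) {n : ℕ} (hn : 0 < n) {T : ℝ≥0}
    (hT : T ≤ n * h) :
    P {ω | u ≤ ⨆ (x : EuclideanSpace ℝ (Fin d)) (_ : ‖x‖ ≤ r) (t : ℝ≥0) (_ : t ≤ T),
        edist (φ 0 t ω x) (φ 0 t ω 0)} ≤
      m ^ (n + 1) * ENNReal.ofReal r ^ p / (ρ₀ : ℝ≥0∞) ^ p := by
  refine measure_le_of_eventually_mem
    (A := fun N => {ω | ∃ j ≤ n * N, (ρ₀ : ℝ≥0∞) ≤ osc (φ 0 (j * (h / N)) ω) 0 r}) ?_ ?_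
  · filter_upwards [eventually_gt_atTop 0] with N hN
    have h0 : (ρ₀ : ℝ≥0∞) ^ p ≠ 0 :=
      (ENNReal.rpow_pos (by exact_mod_cast hρ₀) ENNReal.coe_ne_top).ne'
    rw [ENNReal.le_div_iff_mul_le (Or.inl h0)
      (Or.inl (ENNReal.rpow_ne_top_of_nonneg hp.le ENNReal.coe_ne_top)), mul_comm]
    exact hφ.measure_grid_osc_ge_le hp hm hstep hr hN hn
  · intro ω hω
    -- As `ρ₀ < u` strictly, some point exceeds `ρ₀` strictly at some time, and by continuity also
    -- at nearby grid times.
    obtain ⟨x, hx⟩ := lt_iSup_iff.1 (hu.trans_le hω)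
    obtain ⟨hxr, hx⟩ := lt_iSup_iff.1 hx
    obtain ⟨t, hx⟩ := lt_iSup_iff.1 hx
    obtain ⟨htT, hx⟩ := lt_iSup_iff.1 hx
    have hc : ∀ x, Continuous fun t : ℝ≥0 => φ 0 t ω x := fun x =>
      (hφ.continuous_uncurry ω).comp (by fun_prop : Continuous fun t : ℝ≥0 => (t, x))
    have hlim := (((hc x).edist (hc 0)).tendsto t).comp (tendsto_grid hh t)
    filter_upwards [hlim.eventually (lt_mem_nhds hx)] with N hNx
    refine ⟨gridIndex h N t, gridIndex_le hh N (htT.trans hT), hNx.le.trans ?_⟩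
    have := edist_le_osc (hφ.isHomeomorph 0 (gridIndex h N t * (h / N)) zero_le ω).continuous 0 hxr
    rwa [zero_add] at this

end Flow

/-! ### Exponential rate and choice of parameters. -/

/-- The exponential rate of an eventually exponentially bounded function. -/
theorem limsup_inv_mul_log_le {f : ℝ≥0 → ℝ≥0∞} {A B : ℝ}
    (hf : ∀ᶠ T : ℝ≥0 in atTop, f T ≤ ENNReal.ofReal (Real.exp (A + B * T))) :
    limsup (fun T : ℝ≥0 => ((1 / T : ℝ) : EReal) * ENNReal.log (f T)) atTop ≤ (B : EReal) := by
  have hlim : Tendsto (fun T : ℝ≥0 => ((A * (T : ℝ)⁻¹ + B : ℝ) : EReal)) atTop (𝓝 (B : EReal)) := by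
    rw [EReal.tendsto_coe]
    have h1 : Tendsto (fun T : ℝ≥0 => ((T : ℝ))⁻¹) atTop (𝓝 0) :=
      tendsto_inv_atTop_zero.comp (NNReal.tendsto_coe_atTop.2 tendsto_id)
    simpa using (h1.const_mul A).add_const B
  rw [← hlim.limsup_eq]
  refine limsup_le_limsup ?_
  filter_upwards [hf, eventually_gt_atTop 0] with T hT hT0
  have hT' : (0 : ℝ) < T := hT0
  have h1 : ENNReal.log (f T) ≤ ((A + B * T : ℝ) : EReal) := by
    refine (ENNReal.log_monotone hT).trans ?_
    rw [ENNReal.log_ofReal_of_pos (Real.exp_pos _), Real.log_exp]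
  calc ((1 / T : ℝ) : EReal) * ENNReal.log (f T)
      ≤ ((1 / T : ℝ) : EReal) * ((A + B * T : ℝ) : EReal) := by
        refine mul_le_mul_of_nonneg_left h1 ?_
        exact_mod_cast (by positivity : (0 : ℝ) ≤ 1 / T)
    _ = _ := by
        rw [← EReal.coe_mul]
        congr 1
        field_simp

theorem mainTheorem3 {d : ℕ} {Ω : Type*} [MeasurableSpace Ω] (P : Measure Ω)
    [IsProbabilityMeasure P]
    (φ : ℝ≥0 → ℝ≥0 → Ω → EuclideanSpace ℝ (Fin d) → EuclideanSpace ℝ (Fin d))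
    (hφ : IsTranslationInvariantBrownianFlow φ P)
    (hdiff : ∀ (ω : Ω) (t : ℝ≥0), Differentiable ℝ (φ 0 t ω))
    (hcont : ∀ ω : Ω, Continuous
      (fun p : ℝ≥0 × EuclideanSpace ℝ (Fin d) => fderiv ℝ (φ 0 p.1 ω) p.2))
    (W : ℝ≥0 → Ω → ℝ) (hW : IsBrownianReal W P)
    (c Λ σ : ℝ) (hc : 1 ≤ c) (hΛ : 0 ≤ Λ) (hσ : 0 < σ)
    (hbound : ∀ T : ℝ≥0, ∀ᵐ ω ∂P,
      ‖fderiv ℝ (φ 0 T ω) 0‖ ≤ c * Real.exp (⨆ s : Set.Icc (0 : ℝ≥0) T, (Λ * s + σ * W s ω)))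
    (u : ℝ) (hu : 0 < u) (ξ : ℝ) (hξ : 0 ≤ ξ) :
    limsup (fun T : ℝ≥0 => ((1 / T : ℝ) : EReal) *
        ENNReal.log (P {ω | ENNReal.ofReal u ≤
          ⨆ (x : EuclideanSpace ℝ (Fin d)) (_ : ‖x‖ ≤ Real.exp (-(Λ + ξ) * T))
            (t : ℝ≥0) (_ : t ≤ T), edist (φ 0 t ω x) (φ 0 t ω 0)})) atTop
      ≤ ((-(ξ ^ 2 / (2 * σ ^ 2)) : ℝ) : EReal) := by
  -- For `ξ = 0` the exponent `p` would vanish, but the trivial bound by `1` is enough.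
  rcases hξ.eq_or_lt with rfl | hξ
  · have h0 : (-(0 ^ 2 / (2 * σ ^ 2)) : ℝ) = 0 := by simp
    rw [h0]
    refine limsup_inv_mul_log_le (A := 0) (B := 0) (Eventually.of_forall fun T => ?_)
    simpa using prob_le_one
  rw [← EReal.le_of_forall_lt_iff_le]
  intro η hη
  have hη' : -(ξ ^ 2 / (2 * σ ^ 2)) < η := by exact_mod_cast hη
  set p := ξ / σ ^ 2 with hp_def
  have hp : 0 < p := by positivity
  have hpσ : p * σ = ξ / σ := by rw [hp_def]; field_simp
  -- At `b = p σ` the expression equals `-ξ² / (2 σ²)`; the moment bound needs `b` strictly larger.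
  obtain ⟨b, hb, hbη⟩ : ∃ b, p * σ < b ∧ b ^ 2 / 2 - p * ξ < η := by
    have hc : Tendsto (fun b : ℝ => b ^ 2 / 2 - p * ξ) (𝓝[>] (p * σ))
        (𝓝 ((p * σ) ^ 2 / 2 - p * ξ)) :=
      ((by fun_prop : Continuous fun b : ℝ => b ^ 2 / 2 - p * ξ).tendsto _).mono_left
        nhdsWithin_le_nhds
    have hval : (p * σ) ^ 2 / 2 - p * ξ < η := by
      refine lt_of_eq_of_lt ?_ hη'
      rw [hpσ, hp_def]; field_simp; ring
    have hgt : ∀ᶠ b in 𝓝[>] (p * σ), p * σ < b := self_mem_nhdsWithin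
    exact (hgt.and (hc.eventually (gt_mem_nhds hval))).exists
  set K : ℝ := c ^ p * (1 + Real.exp (p * σ) / (1 - Real.exp (p * σ - b))) with hK
  have hexp1 : Real.exp (p * σ - b) < 1 := by
    rw [← Real.exp_zero]; exact Real.exp_lt_exp.2 (by linarith)
  have hK0 : 0 ≤ K := by
    have : 0 < 1 - Real.exp (p * σ - b) := by linarith
    positivity
  -- The summand `2` ensures `2 ≤ m`, as the geometric sum requires, and lets `m` absorb the
  -- additive constants of the one-step bound.
  set K' : ℝ := 2 ^ p * (K + 1) + 2 with hK'
  have hK'2 : 2 ≤ K' := by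
    have : 0 ≤ (2 : ℝ) ^ p * (K + 1) := by positivity
    linarith
  set κ : ℝ := p * Λ + b ^ 2 / 2 with hκ
  have hκ0 : 0 ≤ κ := by positivity
  -- `K'` does not depend on `h`, so its cost per unit time, `log K' / h`, vanishes for long steps.
  obtain ⟨h, hh, hhη⟩ : ∃ h : ℝ≥0, 0 < h ∧ Real.log K' / h + (b ^ 2 / 2 - p * ξ) < η := by
    have hlim : Tendsto (fun h : ℝ≥0 => Real.log K' / h + (b ^ 2 / 2 - p * ξ)) atTop
        (𝓝 (0 + (b ^ 2 / 2 - p * ξ))) :=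
      (tendsto_const_nhds.div_atTop (NNReal.tendsto_coe_atTop.2 tendsto_id)).add_const _
    rw [zero_add] at hlim
    exact ((eventually_gt_atTop 0).and (hlim.eventually (gt_mem_nhds hbη))).exists
  have hh' : (0 : ℝ) < h := hh
  set m : ℝ := K' * Real.exp (κ * h) with hm
  have hexp : 1 ≤ Real.exp (κ * h) := Real.one_le_exp (by positivity)
  have hm2 : 2 ≤ m := hK'2.trans (le_mul_of_one_le_right (by linarith) hexp)
  have hmom : ∫⁻ ω, (⨆ k, ‖fderiv ℝ (φ 0 (timeSeq h k) ω) 0‖ₑ) ^ p ∂P ≤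
      ENNReal.ofReal (K * Real.exp (κ * h)) :=
    lintegral_iSup_enorm_fderiv_rpow_le hW hc hΛ hσ hbound hp hb hh
  have hq0 : 0 < p + d + 1 := by positivity
  -- The exponent `p + d + 1` exceeds `p`, `d` and `1`. Its moment need only be finite, so any `b`
  -- above `(p + d + 1) * σ` serves.
  obtain ⟨ρ₀, hρ₀, hρu, hstep⟩ := hφ.exists_lintegral_osc_le hdiff hcont h hp
    (q := p + d + 1) (by linarith [(Nat.cast_nonneg d : (0 : ℝ) ≤ d)])
    (by linarith [(Nat.cast_nonneg d : (0 : ℝ) ≤ d)]) (by linarith)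
    ((lintegral_iSup_enorm_fderiv_rpow_le hW hc hΛ hσ hbound hq0
      (b := (p + d + 1) * σ + 1) (by linarith) hh).trans_lt ENNReal.ofReal_lt_top).ne
    (Real.toNNReal_pos.2 hu)
  have hmE : 2 ^ p * (∫⁻ ω, (⨆ k, ‖fderiv ℝ (φ 0 (timeSeq h k) ω) 0‖ₑ) ^ p ∂P + 1) + 1 ≤
      ENNReal.ofReal m := by
    calc _ ≤ 2 ^ p * (ENNReal.ofReal (K * Real.exp (κ * h)) + 1) + 1 := by gcongr
      _ = ENNReal.ofReal (2 ^ p * (K * Real.exp (κ * h) + 1) + 1) := by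
          rw [ENNReal.ofReal_add (by positivity) zero_le_one,
            ENNReal.ofReal_mul (q := K * Real.exp (κ * h) + 1) (by positivity),
            ENNReal.ofReal_add (by positivity) zero_le_one,
            ENNReal.ofReal_one, ← ENNReal.ofReal_rpow_of_pos two_pos, ENNReal.ofReal_ofNat]
      _ ≤ ENNReal.ofReal m := by
          refine ENNReal.ofReal_le_ofReal ?_
          have h2 : 0 ≤ (2 : ℝ) ^ p := by positivity
          have h3 : m = 2 ^ p * (K * Real.exp (κ * h)) + 2 ^ p * Real.exp (κ * h) +
            2 * Real.exp (κ * h) := by rw [hm, hK']; ring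
          have h4 : (2 : ℝ) ^ p * 1 ≤ 2 ^ p * Real.exp (κ * h) := by gcongr
          rw [h3]
          linarith
  have hstep' : ∀ ρ : ℝ≥0, ρ ≤ ρ₀ → ∫⁻ ω, (⨆ k, osc (φ 0 (timeSeq h k) ω) 0 ρ) ^ p ∂P ≤
      ENNReal.ofReal m * (ρ : ℝ≥0∞) ^ p := fun ρ hρ =>
    (hstep ρ hρ).trans (mul_le_mul_left hmE _)
  have hm0 : 0 < m := by linarith
  have hlogm : Real.log m = Real.log K' + κ * h := by
    rw [hm, Real.log_mul (by linarith) (Real.exp_pos _).ne', Real.log_exp]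
  have hρ₀' : (0 : ℝ) < ρ₀ := hρ₀
  -- The term `2 * Real.log m` comes from `⌈T / h⌉₊ + 1 ≤ T / h + 2`.
  refine le_trans (limsup_inv_mul_log_le (A := 2 * Real.log m - p * Real.log ρ₀)
    (B := Real.log m / h - p * (Λ + ξ)) ?_) ?_
  · filter_upwards [eventually_gt_atTop 0] with T hT
    have hn : 0 < ⌈T / h⌉₊ := Nat.ceil_pos.2 (by positivity)
    have hTn : T ≤ ⌈T / h⌉₊ * h := by
      rw [← div_le_iff₀ hh]; exact Nat.le_ceil _
    refine (hφ.measure_iSup_edist_ge_le hh hp (m := ENNReal.ofReal m) ?_ hρ₀ hstep'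
      (Real.exp_pos _).le (u := ENNReal.ofReal u) ?_ hn hTn).trans ?_
    · rw [← ENNReal.ofReal_ofNat]; exact ENNReal.ofReal_le_ofReal hm2
    · exact ENNReal.coe_lt_coe.2 hρu
    · rw [← ENNReal.ofReal_pow hm0.le, ENNReal.ofReal_rpow_of_pos (Real.exp_pos _),
        ← ENNReal.ofReal_mul (by positivity), ← ENNReal.ofReal_coe_nnreal,
        ENNReal.ofReal_rpow_of_pos hρ₀', ← ENNReal.ofReal_div_of_pos (by positivity)]
      refine ENNReal.ofReal_le_ofReal ?_
      have hceil : ((⌈T / h⌉₊ : ℕ) : ℝ) ≤ T / h + 1 := by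
        have := (Nat.ceil_lt_add_one (zero_le (a := T / h))).le
        exact_mod_cast this
      have hlogm0 : 0 ≤ Real.log m := Real.log_nonneg (by linarith)
      have e1 : m ^ (⌈T / h⌉₊ + 1) = Real.exp (Real.log m * (⌈T / h⌉₊ + 1)) := by
        rw [← Real.exp_log hm0, ← Real.exp_nat_mul, Real.log_exp]
        push_cast
        ring_nf
      have e2 : (ρ₀ : ℝ) ^ p = Real.exp (Real.log ρ₀ * p) := Real.rpow_def_of_pos hρ₀' p
      rw [e1, e2, ← Real.exp_mul, ← Real.exp_add, ← Real.exp_sub]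
      refine Real.exp_le_exp.2 ?_
      have e3 : Real.log m * (⌈T / h⌉₊ + 1) ≤ Real.log m * (T / h + 1 + 1) := by gcongr
      have e4 : Real.log m * (T / h + 1 + 1) = Real.log m / h * T + 2 * Real.log m := by ring
      linarith
  · rw [EReal.coe_le_coe_iff, hlogm]
    have : (Real.log K' + κ * h) / h - p * (Λ + ξ) = Real.log K' / h + (b ^ 2 / 2 - p * ξ) := by
      rw [hκ]; field_simp; ring
    rw [this]
    exact hhη.le
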